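/- Let $\pi$ be the group with presentation \[ \langle a,b,t\mid ta^2t^{-1}=b,\ tabt^{-1}=a^2,\ a^4=b^2=(ab)^2\rangle , \] which is an HNN extension with base the generalized quaternion group $Q(16)=\langle a,b\mid a^4=b^2=(ab)^2\rangle$, associated subgroups $\langle a^2,ab\rangle\cong\langle a^2,b\rangle\cong Q(8)$ and stable letter $t$. Let $f$ and $g$ be the automorphisms of $\pi$ determined by $f(a)=a$, $f(b)=b$, $f(t)=a^4t$ and $g(a)=a^{-1}$, $g(b)=a^{-2}b$, $g(t)=at$. Write $H_n(\pi)=H_n(\pi;\mathbb{Z})$ for group homology with trivial integral coefficients. Then $H_4(\pi)$ is a (finite) cyclic group of order dividing $8$; $H_3(\pi)\neq 0$; and $f$ and $g$ induce the identity on $H_4(\pi)$. -/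

import Mathlib

open CategoryTheory

namespace KnotGroup

/-- The names of the three generators of the group `π`. -/
inductive Gen : Type
  | a
  | b
  | t

/-- The relators of the presentation
`⟨a, b, t ∣ t a² t⁻¹ = b, t (a b) t⁻¹ = a², a⁴ = b² = (a b)²⟩`. -/
def relators : Set (FreeGroup Gen) :=
  let a := FreeGroup.of Gen.a
  let b := FreeGroup.of Gen.b
  let t := FreeGroup.of Gen.t
  {t * a ^ 2 * t⁻¹ * b⁻¹,
   t * (a * b) * t⁻¹ * (a ^ 2)⁻¹,
   a ^ 4 * (b ^ 2)⁻¹,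
   b ^ 2 * ((a * b) ^ 2)⁻¹}

/-- The group `π = ⟨a, b, t ∣ t a² t⁻¹ = b, t (a b) t⁻¹ = a², a⁴ = b² = (a b)²⟩`. -/
abbrev Pi : Type := PresentedGroup relators

/-- The generator `a` of `π`. -/
def a : Pi := PresentedGroup.of Gen.a

/-- The generator `b` of `π`. -/
def b : Pi := PresentedGroup.of Gen.b

/-- The generator `t` (the stable letter) of `π`. -/
def t : Pi := PresentedGroup.of Gen.t

theorem rel_one : t * a ^ 2 * t⁻¹ = b := by
  have h : PresentedGroup.mk relators
      (FreeGroup.of Gen.t * FreeGroup.of Gen.a ^ 2 * (FreeGroup.of Gen.t)⁻¹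
        * (FreeGroup.of Gen.b)⁻¹) = 1 :=
    PresentedGroup.one_of_mem (by simp [relators])
  simp only [map_mul, map_pow, map_inv] at h
  exact mul_inv_eq_one.mp h

theorem rel_two : t * (a * b) * t⁻¹ = a ^ 2 := by
  have h : PresentedGroup.mk relators
      (FreeGroup.of Gen.t * (FreeGroup.of Gen.a * FreeGroup.of Gen.b) * (FreeGroup.of Gen.t)⁻¹
        * (FreeGroup.of Gen.a ^ 2)⁻¹) = 1 :=
    PresentedGroup.one_of_mem (by simp [relators])
  simp only [map_mul, map_pow, map_inv] at h
  exact mul_inv_eq_one.mp h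

theorem rel_three : a ^ 4 = b ^ 2 := by
  have h : PresentedGroup.mk relators
      (FreeGroup.of Gen.a ^ 4 * (FreeGroup.of Gen.b ^ 2)⁻¹) = 1 :=
    PresentedGroup.one_of_mem (by simp [relators])
  simp only [map_mul, map_pow, map_inv] at h
  exact mul_inv_eq_one.mp h

theorem rel_four : b ^ 2 = (a * b) ^ 2 := by
  have h : PresentedGroup.mk relators
      (FreeGroup.of Gen.b ^ 2 * ((FreeGroup.of Gen.a * FreeGroup.of Gen.b) ^ 2)⁻¹) = 1 :=
    PresentedGroup.one_of_mem (by simp [relators])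
  simp only [map_mul, map_pow, map_inv] at h
  exact mul_inv_eq_one.mp h

theorem b_mul_a : b * a = a⁻¹ * b := by
  have h := rel_four
  rw [pow_two, pow_two] at h
  have h2 : b = a * (b * a) := by
    have : b * b = (a * (b * a)) * b := by rw [h]; group
    exact mul_right_cancel this
  rw [eq_inv_mul_iff_mul_eq]
  exact h2.symm

theorem b_mul_a_pow (n : ℕ) : b * a ^ n = (a ^ n)⁻¹ * b := by
  have h : SemiconjBy b a a⁻¹ := b_mul_a
  have h2 := h.pow_right n
  rw [inv_pow] at h2
  exact h2

theorem a_pow_eight : a ^ 8 = 1 := by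
  have h1 := b_mul_a_pow 4
  rw [rel_three] at h1
  have h2 : b ^ 2 = (b ^ 2)⁻¹ := by
    apply mul_right_cancel (b := b)
    rw [← h1]; group
  have h3 : a ^ 8 = b ^ 2 * b ^ 2 := by
    rw [← rel_three, ← pow_add]
  rw [h3]
  nth_rewrite 1 [h2]
  exact inv_mul_cancel _

theorem t_mul_a_pow_four : t * a ^ 4 = a ^ 4 * t := by
  have h : (t * a ^ 2 * t⁻¹) ^ 2 = a ^ 4 := by rw [rel_one, rel_three]
  rw [conj_pow, ← pow_mul] at h
  exact mul_inv_eq_iff_eq_mul.mp h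

theorem a_pow_inv_mul_b_sq (n : ℕ) : ((a ^ n)⁻¹ * b) ^ 2 = b ^ 2 := by
  rw [pow_two]
  nth_rewrite 1 [← b_mul_a_pow]
  rw [mul_assoc, mul_inv_cancel_left, pow_two]

/-- The homomorphism out of `π` with prescribed values on the generators. -/
def homOfImages {G : Type*} [Group G] (x y z : G)
    (h1 : z * x ^ 2 * z⁻¹ = y) (h2 : z * (x * y) * z⁻¹ = x ^ 2)
    (h3 : x ^ 4 = y ^ 2) (h4 : y ^ 2 = (x * y) ^ 2) : Pi →* G :=
  PresentedGroup.toGroup (f := fun i : Gen => match i with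
    | Gen.a => x
    | Gen.b => y
    | Gen.t => z) (by
    intro r hr
    simp only [relators, Set.mem_insert_iff, Set.mem_singleton_iff] at hr
    rcases hr with rfl | rfl | rfl | rfl
    · simp only [map_mul, map_pow, map_inv, FreeGroup.lift_apply_of]
      rw [h1, mul_inv_cancel]
    · simp only [map_mul, map_pow, map_inv, FreeGroup.lift_apply_of]
      rw [h2, mul_inv_cancel]
    · simp only [map_mul, map_pow, map_inv, FreeGroup.lift_apply_of]
      rw [h3, mul_inv_cancel]
    · simp only [map_mul, map_pow, map_inv, FreeGroup.lift_apply_of]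
      rw [h4, mul_inv_cancel])

section

variable {G : Type*} [Group G] {x y z : G}
    (h1 : z * x ^ 2 * z⁻¹ = y) (h2 : z * (x * y) * z⁻¹ = x ^ 2)
    (h3 : x ^ 4 = y ^ 2) (h4 : y ^ 2 = (x * y) ^ 2)

theorem homOfImages_a : homOfImages x y z h1 h2 h3 h4 a = x := PresentedGroup.toGroup.of _

theorem homOfImages_b : homOfImages x y z h1 h2 h3 h4 b = y := PresentedGroup.toGroup.of _

theorem homOfImages_t : homOfImages x y z h1 h2 h3 h4 t = z := PresentedGroup.toGroup.of _

end

theorem hom_ext {G : Type*} [Group G] {p q : Pi →* G}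
    (ha : p a = q a) (hb : p b = q b) (ht : p t = q t) : p = q := by
  apply PresentedGroup.ext
  intro i
  cases i
  · exact ha
  · exact hb
  · exact ht

/-- The endomorphism of `π` with `a ↦ a`, `b ↦ b`, `t ↦ a⁴ t`. -/
def fHom : Pi →* Pi :=
  homOfImages a b (a ^ 4 * t)
    (by
      rw [← rel_one]
      have h : a ^ 4 * t = t * a ^ 4 := t_mul_a_pow_four.symm
      rw [h]
      group)
    (by
      have h : a ^ 4 * t * (a * b) * (a ^ 4 * t)⁻¹
          = a ^ 4 * (t * (a * b) * t⁻¹) * (a ^ 4)⁻¹ := by group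
      rw [h, rel_two]
      group)
    rel_three rel_four

/-- The endomorphism of `π` with `a ↦ a⁻¹`, `b ↦ a⁻² b`, `t ↦ a t`. -/
def gHom : Pi →* Pi :=
  homOfImages a⁻¹ ((a ^ 2)⁻¹ * b) (a * t)
    (by
      have h : a * t * a⁻¹ ^ 2 * (a * t)⁻¹ = a * (t * a ^ 2 * t⁻¹)⁻¹ * a⁻¹ := by group
      rw [h, rel_one]
      have hb : b⁻¹ = a ^ 4 * b := by
        have h8 : a ^ 4 * a ^ 4 = 1 := by rw [← pow_add]; exact a_pow_eight
        rw [inv_eq_iff_mul_eq_one]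
        have h4 : b * a ^ 4 = a ^ 4 * b := by
          rw [rel_three]; group
        rw [← mul_assoc, h4, mul_assoc, ← pow_two, ← rel_three, h8]
      have ha : b * a⁻¹ = a * b := by
        rw [mul_inv_eq_iff_eq_mul, mul_assoc, b_mul_a]; group
      rw [hb, mul_assoc, mul_assoc, ha]
      have h6 : a * (a ^ 4 * (a * b)) = (a ^ 2)⁻¹ * a ^ 8 * b := by group
      rw [h6, a_pow_eight, mul_one])
    (by
      have h : a * t * (a⁻¹ * ((a ^ 2)⁻¹ * b)) * (a * t)⁻¹
          = a * (t * a ^ 4 * t⁻¹)⁻¹ * (t * (a * b) * t⁻¹) * a⁻¹ := by group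
      rw [h, rel_two, t_mul_a_pow_four]
      group)
    (by
      rw [a_pow_inv_mul_b_sq, ← rel_three, inv_pow, inv_eq_iff_mul_eq_one, ← pow_add]
      exact a_pow_eight)
    (by
      have h : a⁻¹ * ((a ^ 2)⁻¹ * b) = (a ^ 3)⁻¹ * b := by group
      rw [h, a_pow_inv_mul_b_sq, a_pow_inv_mul_b_sq])

@[simp] theorem fHom_a : fHom a = a := homOfImages_a _ _ _ _

@[simp] theorem fHom_b : fHom b = b := homOfImages_b _ _ _ _

@[simp] theorem fHom_t : fHom t = a ^ 4 * t := homOfImages_t _ _ _ _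

@[simp] theorem gHom_a : gHom a = a⁻¹ := homOfImages_a _ _ _ _

@[simp] theorem gHom_b : gHom b = (a ^ 2)⁻¹ * b := homOfImages_b _ _ _ _

@[simp] theorem gHom_t : gHom t = a * t := homOfImages_t _ _ _ _

theorem fHom_comp_fHom : fHom.comp fHom = MonoidHom.id Pi := by
  apply hom_ext
  · simp
  · simp
  · simp [← mul_assoc, ← pow_add, a_pow_eight]

theorem gHom_comp_gHom : gHom.comp gHom = MonoidHom.id Pi := by
  apply hom_ext
  · simp
  · simp
  · simp

/-- The automorphism `f` of `π` with `f(a) = a`, `f(b) = b` and `f(t) = a⁴ t`. -/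
def f : Pi ≃* Pi := fHom.toMulEquiv fHom fHom_comp_fHom fHom_comp_fHom

/-- The automorphism `g` of `π` with `g(a) = a⁻¹`, `g(b) = a⁻² b` and `g(t) = a t`. -/
def g : Pi ≃* Pi := gHom.toMulEquiv gHom gHom_comp_gHom gHom_comp_gHom

theorem f_images : f a = a ∧ f b = b ∧ f t = a ^ 4 * t := ⟨fHom_a, fHom_b, fHom_t⟩

theorem g_images : g a = a⁻¹ ∧ g b = (a ^ 2)⁻¹ * b ∧ g t = a * t := ⟨gHom_a, gHom_b, gHom_t⟩

end KnotGroup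

/-- The homology group `H_n(G) = H_n(G; ℤ)` with coefficients in the trivial module `ℤ`. -/
noncomputable abbrev integralHomology (G : Type) [Group G] (n : ℕ) : ModuleCat ℤ :=
  groupHomology (Rep.trivial ℤ G ℤ) n

/-- The map `H_n(G) → H_n(K)` induced by a group homomorphism `G → K`
(and the identity on the coefficients `ℤ`). -/
noncomputable abbrev integralHomologyMap {G K : Type} [Group G] [Group K] (p : G →* K) (n : ℕ) :
    integralHomology G n ⟶ integralHomology K n :=
  groupHomology.map (A := Rep.trivial ℤ G ℤ) (B := Rep.trivial ℤ K ℤ) p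
    (𝟙 (Rep.trivial ℤ G ℤ)) n

/-! By Bass–Serre theory `π` acts on a tree with vertices `π/Q(16)` and edges `π/Q(8)`, which gives
an exact sequence `0 → ℤ[π/Q(8)] → ℤ[π/Q(16)] → ℤ → 0`. The two permutation modules are realised as
the left ideals of `ℤ[π]` generated by the norm elements of the quaternion subgroups
(`treeSeq_shortExact`). Since their homology is that of the subgroups, the long exact sequence reads
`H₄(Q(16)) → H₄(π) → H₃(Q(8)) → H₃(Q(16)) → H₃(π)`.

Shapiro's lemma is not invoked. The four-periodic free resolution of a generalized quaternion group
of order `4m`, induced up to `ℤ[π]`, resolves the norm ideal (`QuaternionPair.periodicResolution`).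
Dimension shifting along it shows that `H₄` of the ideal vanishes (`isZero_four`), and embeds `H₃`
in a cyclic group of order `4m` (`mono_dimShift`) with a generator in the image
(`exists_dimShift_eq_gen`). Hence `H₄(π)` embeds in a cyclic group of order `8`. If `H₃(π)` were
zero, a group killed by `8` would surject onto one with an element of order `16`.

For an automorphism `p` equal to `f` or `g` there is `c` in `Q(16)` such that `p` agrees with
conjugation by `c` on `Q(8)`. The map `r ↦ p(r)c` then commutes with all differentials and preserves
augmentations, so it is the identity on `H₃` of the edge module (`QuaternionPair.twistMap_eq_id`).
Naturality and injectivity of the connecting map carry this to `H₄(π)`. -/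

namespace groupHomology

/-! ### Naturality of connecting homomorphisms under change of group -/

section Naturality

variable {k G H : Type} [CommRing k] [Group G] [Group H]

theorem δ_comp_map {X : ShortComplex (Rep.{0} k G)} {Y : ShortComplex (Rep.{0} k H)}
    (hX : X.ShortExact) (hY : Y.ShortExact) (p : G →* H)
    (τ₁ : X.X₁ ⟶ Rep.res p Y.X₁) (τ₂ : X.X₂ ⟶ Rep.res p Y.X₂) (τ₃ : X.X₃ ⟶ Rep.res p Y.X₃)
    (h₁₂ : ∀ x, Y.f.hom (τ₁.hom x) = τ₂.hom (X.f.hom x))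
    (h₂₃ : ∀ x, Y.g.hom (τ₂.hom x) = τ₃.hom (X.g.hom x))
    (i j : ℕ) (hij : j + 1 = i) :
    δ hX i j hij ≫ map p τ₁ j = map p τ₃ i ≫ δ hY i j hij := by
  let Φ : X.map (chainsFunctor k G) ⟶ Y.map (chainsFunctor k H) :=
    { τ₁ := chainsMap p τ₁
      τ₂ := chainsMap p τ₂
      τ₃ := chainsMap p τ₃
      comm₁₂ := by
        refine (chainsMap_comp p (MonoidHom.id H) τ₁ Y.f).symm.trans
          (Eq.trans ?_ (chainsMap_comp (MonoidHom.id G) p X.f τ₂))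
        refine chainsMap_congr rfl ?_
        ext x
        exact h₁₂ x
      comm₂₃ := by
        refine (chainsMap_comp p (MonoidHom.id H) τ₂ Y.g).symm.trans
          (Eq.trans ?_ (chainsMap_comp (MonoidHom.id G) p X.g τ₃))
        refine chainsMap_congr rfl ?_
        ext x
        exact h₂₃ x }
  exact HomologicalComplex.HomologySequence.δ_naturality Φ
    (map_chainsFunctor_shortExact hX) (map_chainsFunctor_shortExact hY) i j hij

theorem H0π_map_apply {A : Rep.{0} k G} {B : Rep.{0} k H} (p : G →* H) (τ : A ⟶ Rep.res p B)
    (x : A) : map p τ 0 (H0π A x) = H0π B (τ.hom x) := by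
  have := congr($(H0π_comp_map p τ) x)
  exact this

end Naturality

end groupHomology

/-! ### Modules over the group ring as representations -/

namespace GroupRing

open groupHomology

variable {G H : Type} [Group G] [Group H]

/-- The representation of `G` underlying a module over the integral group ring of `G`. -/
noncomputable def rho (M : Type) [AddCommGroup M] [Module (MonoidAlgebra ℤ G) M] :
    Representation ℤ G M where
  toFun g := (DistribSMul.toAddMonoidHom M (MonoidAlgebra.of ℤ G g)).toIntLinearMap
  map_one' := by ext m; simp [← MonoidAlgebra.one_def]
  map_mul' g h := by
    ext m
    simp only [map_mul]
    exact mul_smul _ _ m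

/-- The representation of `G` underlying a module over the integral group ring of `G`, as an object
of the category of representations. -/
noncomputable abbrev rep (M : Type) [AddCommGroup M] [Module (MonoidAlgebra ℤ G) M] :
    Rep.{0} ℤ G := Rep.of (rho (G := G) M)

section

variable {M N : Type} [AddCommGroup M] [Module (MonoidAlgebra ℤ G) M]
  [AddCommGroup N] [Module (MonoidAlgebra ℤ G) N]

theorem rho_apply (g : G) (m : M) : rho M g m = MonoidAlgebra.of ℤ G g • m := rfl

/-- The morphism of representations underlying a linear map over the group ring. -/
noncomputable def repHom (d : M →ₗ[MonoidAlgebra ℤ G] N) : rep (G := G) M ⟶ rep N :=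
  Rep.ofHom ⟨d.toAddMonoidHom.toIntLinearMap, fun g => by ext m; exact d.map_smul _ m⟩

/-- The morphism of representations given by an additive map that is semilinear with respect to a
homomorphism of groups. -/
noncomputable def twistHom {N : Type} [AddCommGroup N] [Module (MonoidAlgebra ℤ H) N]
    (p : G →* H) (α : M →+ N)
    (h : ∀ g m, α (MonoidAlgebra.of ℤ G g • m) = MonoidAlgebra.of ℤ H (p g) • α m) :
    rep (G := G) M ⟶ Rep.res p (rep N) :=
  Rep.ofHom ⟨α.toIntLinearMap, fun g => by ext m; exact h g m⟩

end

section ShortExact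

theorem shortExact_of_exact {k G : Type} [CommRing k] [Group G] (X : ShortComplex (Rep.{0} k G))
    (hf : Function.Injective X.f.hom) (hfg : Function.Exact X.f.hom X.g.hom)
    (hg : Function.Surjective X.g.hom) : X.ShortExact where
  exact := by
    refine (ShortComplex.exact_map_iff_of_faithful X
      (forget₂ (Rep.{0} k G) (ModuleCat.{0} k))).1 ?_
    rw [ShortComplex.moduleCat_exact_iff]
    exact fun x hx => (hfg x).1 hx
  mono_f := (Rep.mono_iff_injective _).2 hf
  epi_g := (Rep.epi_iff_surjective _).2 hg


variable {P P' Q : Type} [AddCommGroup P] [Module (MonoidAlgebra ℤ G) P]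
  [AddCommGroup P'] [Module (MonoidAlgebra ℤ G) P'] [AddCommGroup Q] [Module (MonoidAlgebra ℤ G) Q]

/-- The short complex `range d' ⟶ P ⟶ range d` cut out of `P' ⟶ P ⟶ Q`. -/
noncomputable def rangeSeq (d' : P' →ₗ[MonoidAlgebra ℤ G] P) (d : P →ₗ[MonoidAlgebra ℤ G] Q)
    (h : Function.Exact d' d) : ShortComplex (Rep.{0} ℤ G) where
  X₁ := rep (LinearMap.range d')
  X₂ := rep P
  X₃ := rep (LinearMap.range d)
  f := repHom (LinearMap.range d').subtype
  g := repHom d.rangeRestrict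
  zero := by
    ext m
    exact (h _).2 m.2

theorem rangeSeq_shortExact (d' : P' →ₗ[MonoidAlgebra ℤ G] P) (d : P →ₗ[MonoidAlgebra ℤ G] Q)
    (h : Function.Exact d' d) : (rangeSeq d' d h).ShortExact := by
  refine shortExact_of_exact _ Subtype.val_injective (fun x => ?_) d.surjective_rangeRestrict
  constructor
  · intro hx
    obtain ⟨y, hy⟩ := (h x).1 congr(($hx).1)
    exact ⟨⟨x, y, hy⟩, rfl⟩
  · rintro ⟨y, rfl⟩
    exact Subtype.ext ((h _).2 y.2)

end ShortExact

end GroupRing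

/-! ### Face maps on tuples with a prepended entry -/

namespace Fin

variable {α : Type*} (op : α → α → α)

theorem contractNth_succ_cons {n : ℕ} (a : α) (g : Fin (n + 1) → α) (j : Fin (n + 1)) :
    contractNth j.succ op (cons a g : Fin (n + 2) → α) = cons a (contractNth j op g) := by
  ext k
  refine Fin.cases ?_ (fun k => ?_) k
  · rw [contractNth_apply_of_lt _ _ _ _ (by simp)]
    simp
  · rcases lt_trichotomy (k : ℕ) (j : ℕ) with h | h | h
    · rw [contractNth_apply_of_lt _ _ _ _ (by simpa using h), cons_succ,
        contractNth_apply_of_lt _ _ _ _ h, castSucc_succ, cons_succ]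
    · rw [contractNth_apply_of_eq _ _ _ _ (by simpa using h), cons_succ, cons_succ,
        contractNth_apply_of_eq _ _ _ _ h, castSucc_succ, cons_succ]
    · rw [contractNth_apply_of_gt _ _ _ _ (by simpa using h), cons_succ, cons_succ,
        contractNth_apply_of_gt _ _ _ _ h]

theorem contractNth_zero_cons {n : ℕ} (a : α) (g : Fin (n + 1) → α) :
    contractNth 0 op (cons a g : Fin (n + 2) → α) = cons (op a (g 0)) (tail g) := by
  ext k
  refine Fin.cases ?_ (fun k => ?_) k
  · rw [contractNth_apply_of_eq _ _ _ _ (by simp)]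
    simp
  · rw [contractNth_apply_of_gt _ _ _ _ (by simp)]
    simp [tail]

end Fin

/-! ### Acyclicity of the group ring -/

namespace GroupRing

open groupHomology

variable {G : Type} [Group G]

/-- A contracting homotopy of the chains with coefficients in the group ring. -/
noncomputable def contraction (n : ℕ) :
    ((Fin n → G) →₀ MonoidAlgebra ℤ G) →ₗ[ℤ] ((Fin (n + 1) → G) →₀ MonoidAlgebra ℤ G) :=
  Finsupp.lsum ℤ fun g =>
    Finsupp.lift _ ℤ G (fun h => Finsupp.single (Fin.cons h⁻¹ g) (MonoidAlgebra.single 1 1)) ∘ₗ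
      (MonoidAlgebra.coeffLinearEquiv ℤ).toLinearMap

theorem contraction_single (n : ℕ) (g : Fin n → G) (h : G) :
    contraction n (Finsupp.single g (MonoidAlgebra.single h 1)) =
      Finsupp.single (Fin.cons h⁻¹ g) (MonoidAlgebra.single 1 1) := by
  simp [contraction]

theorem rho_single (g h : G) :
    rho (MonoidAlgebra ℤ G) g (MonoidAlgebra.single h 1) = MonoidAlgebra.single (g * h) 1 := by
  rw [rho_apply, smul_eq_mul, MonoidAlgebra.of_apply, MonoidAlgebra.single_mul_single, one_mul]

/-- The zeroth face of a chain acts on coefficients by the inverse of its first entry, so prepending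
`h⁻¹` to a chain with coefficient `1` gives back the coefficient `h`. The remaining faces of the
longer chain cancel, by the shift of sign, against the prepended faces of the original one. -/
theorem d_contraction_single (n : ℕ) (g : Fin (n + 1) → G) (h : G) :
    inhomogeneousChains.d (rep (G := G) (MonoidAlgebra ℤ G)) (n + 1)
        (contraction (n + 1) (Finsupp.single g (MonoidAlgebra.single h 1))) +
      contraction n (inhomogeneousChains.d (rep (G := G) (MonoidAlgebra ℤ G)) n
        (Finsupp.single g (MonoidAlgebra.single h 1))) =
      Finsupp.single g (MonoidAlgebra.single h 1) := by
  rw [contraction_single, inhomogeneousChains.d_single, inhomogeneousChains.d_single,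
    map_add, map_sum, Fin.sum_univ_succ]
  simp only [Fin.contractNth_succ_cons, Fin.contractNth_zero_cons, rho_single,
    contraction_single, map_smul, Fin.cons_succ, Fin.cons_zero]
  have h₁ : ∀ x : Fin (n + 1), (-1 : ℤ) ^ ((x.succ : ℕ) + 1) = -(-1) ^ ((x : ℕ) + 1) := fun x => by
    rw [Fin.val_succ, pow_succ]; ring
  simp only [h₁, neg_smul, Finset.sum_neg_distrib, inv_inv, mul_one, Fin.coe_ofNat_eq_mod,
    Nat.zero_mod, zero_add, pow_one, one_smul, mul_inv_rev]
  have h₂ : Fin.tail g = fun i => g i.succ := rfl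
  rw [h₂]
  abel

theorem d_contraction (n : ℕ) (z : (Fin (n + 1) → G) →₀ MonoidAlgebra ℤ G) :
    inhomogeneousChains.d (rep (G := G) (MonoidAlgebra ℤ G)) (n + 1) (contraction (n + 1) z) +
      contraction n (inhomogeneousChains.d (rep (G := G) (MonoidAlgebra ℤ G)) n z) = z := by
  let φ : ((Fin (n + 1) → G) →₀ MonoidAlgebra ℤ G) →ₗ[ℤ] ((Fin (n + 1) → G) →₀ MonoidAlgebra ℤ G) :=
    (inhomogeneousChains.d (rep (G := G) (MonoidAlgebra ℤ G)) (n + 1)).hom ∘ₗ contraction (n + 1) +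
      contraction n ∘ₗ (inhomogeneousChains.d (rep (G := G) (MonoidAlgebra ℤ G)) n).hom
  suffices h : φ = LinearMap.id from LinearMap.congr_fun h z
  ext g h : 3
  · exact d_contraction_single n g h

theorem isZero_homology_groupRing (n : ℕ) :
    Limits.IsZero (groupHomology (rep (G := G) (MonoidAlgebra ℤ G)) (n + 1)) := by
  refine HomologicalComplex.ExactAt.isZero_homology ?_
  rw [HomologicalComplex.exactAt_iff' _ (n + 2) (n + 1) n (by simp) (by simp),
    ShortComplex.moduleCat_exact_iff]
  intro z hz
  have hz' : inhomogeneousChains.d (rep (G := G) (MonoidAlgebra ℤ G)) n z = 0 := by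
    rw [← inhomogeneousChains.d_def]
    exact hz
  refine ⟨contraction (n + 1) z, ?_⟩
  have := d_contraction n z
  rw [hz', map_zero, add_zero] at this
  rw [← inhomogeneousChains.d_def] at this
  exact this

/-- The map on homology induced by a linear map over the group ring. -/
noncomputable abbrev homologyMap {M N : Type} [AddCommGroup M] [Module (MonoidAlgebra ℤ G) M]
    [AddCommGroup N] [Module (MonoidAlgebra ℤ G) N] (d : M →ₗ[MonoidAlgebra ℤ G] N) (n : ℕ) :
    groupHomology (rep (G := G) M) n ⟶ groupHomology (rep (G := G) N) n :=
  map (A := rep M) (B := rep N) (MonoidHom.id G) (repHom d) n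

/-! ### Dimension shifting along exact sequences -/

section Shift

variable {P P' Q : Type} [AddCommGroup P] [Module (MonoidAlgebra ℤ G) P]
  [AddCommGroup P'] [Module (MonoidAlgebra ℤ G) P'] [AddCommGroup Q] [Module (MonoidAlgebra ℤ G) Q]

variable (G) in
/-- A module is acyclic if its homology vanishes in positive degrees. -/
def Acyclic (M : Type) [AddCommGroup M] [Module (MonoidAlgebra ℤ G) M] : Prop :=
  ∀ n, Limits.IsZero (groupHomology (rep (G := G) M) (n + 1))

theorem acyclic_groupRing : Acyclic G (MonoidAlgebra ℤ G) := isZero_homology_groupRing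

theorem Acyclic.prod (hP : Acyclic G P) (hQ : Acyclic G Q) : Acyclic G (P × Q) := by
  intro n
  let X : ShortComplex (Rep.{0} ℤ G) :=
    { X₁ := rep P
      X₂ := rep (P × Q)
      X₃ := rep Q
      f := repHom (LinearMap.inl _ P Q)
      g := repHom (LinearMap.snd _ P Q)
      zero := by ext; rfl }
  have hX : X.ShortExact := shortExact_of_exact X LinearMap.inl_injective
    Function.Exact.inl_snd Prod.snd_surjective
  exact (mapShortComplex₂_exact hX (n + 1)).isZero_of_both_zeros
    ((hP n).eq_of_src _ _) ((hQ n).eq_of_tgt _ _)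

variable (d' : P' →ₗ[MonoidAlgebra ℤ G] P) (d : P →ₗ[MonoidAlgebra ℤ G] Q)

/-- The connecting homomorphism `Hₙ₊₁(range d) ⟶ Hₙ(range d')` of an exact pair of maps. -/
noncomputable def shift (h : Function.Exact d' d) (n : ℕ) :
    groupHomology (rep (G := G) (LinearMap.range d)) (n + 1) ⟶
      groupHomology (rep (G := G) (LinearMap.range d')) n :=
  δ (rangeSeq_shortExact d' d h) (n + 1) n rfl

theorem mono_shift (h : Function.Exact d' d) (hP : Acyclic G P) (n : ℕ) : Mono (shift d' d h n) :=
  mono_δ_of_isZero (rangeSeq_shortExact d' d h) n (hP n)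

theorem isIso_shift (h : Function.Exact d' d) (hP : Acyclic G P) (n : ℕ) :
    IsIso (shift d' d h (n + 1)) :=
  isIso_δ_of_isZero (rangeSeq_shortExact d' d h) (n + 1) (hP (n + 1)) (hP n)

theorem map_subtype_shift (h : Function.Exact d' d) (z) :
    homologyMap (LinearMap.range d').subtype 0 (shift d' d h 0 z) = 0 :=
  (mapShortComplex₁ (rangeSeq_shortExact d' d h) (i := 1) (j := 0) rfl).moduleCat_zero_apply z

theorem exists_shift_eq (h : Function.Exact d' d)
    (y : groupHomology (rep (G := G) (LinearMap.range d')) 0)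
    (hy : homologyMap (LinearMap.range d').subtype 0 y = 0) :
    ∃ z, shift d' d h 0 z = y :=
  (ShortComplex.moduleCat_exact_iff _).1
    (mapShortComplex₁_exact (rangeSeq_shortExact d' d h) (i := 1) (j := 0) rfl) y hy

end Shift

end GroupRing

/-! ### Semilinear endomorphisms and their action on homology -/

namespace GroupRing

open groupHomology

variable {G : Type} [Group G]

section Twist

variable {P P' Q : Type} [AddCommGroup P] [Module (MonoidAlgebra ℤ G) P]
  [AddCommGroup P'] [Module (MonoidAlgebra ℤ G) P'] [AddCommGroup Q] [Module (MonoidAlgebra ℤ G) Q]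

/-- An additive endomorphism that is semilinear with respect to an endomorphism of the group. -/
def Semilinear (p : G →* G) (α : P →+ P) : Prop :=
  ∀ g m, α (MonoidAlgebra.of ℤ G g • m) = MonoidAlgebra.of ℤ G (p g) • α m

/-- The endomorphism of the range of `d` induced by a pair of endomorphisms commuting with `d`. -/
def rangeTwist (d : P →ₗ[MonoidAlgebra ℤ G] Q) (α : P →+ P) (β : Q →+ Q)
    (h : ∀ m, d (α m) = β (d m)) : LinearMap.range d →+ LinearMap.range d where
  toFun x := ⟨β x.1, by
    obtain ⟨m, hm⟩ := x.2
    exact ⟨α m, by rw [h, hm]⟩⟩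
  map_zero' := Subtype.ext (map_zero β)
  map_add' x y := Subtype.ext (map_add β x.1 y.1)

theorem Semilinear.rangeTwist {p : G →* G} (d : P →ₗ[MonoidAlgebra ℤ G] Q) (α : P →+ P)
    {β : Q →+ Q} (hβ : Semilinear p β) (h : ∀ m, d (α m) = β (d m)) :
    Semilinear p (rangeTwist d α β h) := fun g x => Subtype.ext (hβ g x.1)

/-- The map on homology induced by a semilinear endomorphism. -/
noncomputable abbrev twistMap (p : G →* G) (α : P →+ P) (h : Semilinear p α) (n : ℕ) :
    groupHomology (rep (G := G) P) n ⟶ groupHomology (rep (G := G) P) n :=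
  map (A := rep P) (B := rep P) p (twistHom p α h) n

/-- The connecting map is injective and commutes with the twists, so triviality of the action passes
up one degree from one syzygy to the previous one. -/
theorem twistMap_rangeTwist_eq_id {p : G →* G} (d' : P' →ₗ[MonoidAlgebra ℤ G] P)
    (d : P →ₗ[MonoidAlgebra ℤ G] Q)
    (h : Function.Exact d' d) (hP : Acyclic G P) (α : P' →+ P') (β : P →+ P) (γ : Q →+ Q)
    (hβ : Semilinear p β) (hγ : Semilinear p γ)
    (h₁ : ∀ m, d' (α m) = β (d' m)) (h₂ : ∀ m, d (β m) = γ (d m)) (n : ℕ)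
    (hid : twistMap p (rangeTwist d' α β h₁) (hβ.rangeTwist d' α h₁) n = 𝟙 _) :
    twistMap p (rangeTwist d β γ h₂) (hγ.rangeTwist d β h₂) (n + 1) = 𝟙 _ := by
  have := mono_shift d' d h hP n
  have key : shift d' d h n ≫ twistMap p (rangeTwist d' α β h₁) (hβ.rangeTwist d' α h₁) n =
      twistMap p (rangeTwist d β γ h₂) (hγ.rangeTwist d β h₂) (n + 1) ≫ shift d' d h n :=
    δ_comp_map (rangeSeq_shortExact d' d h) (rangeSeq_shortExact d' d h) p
      (twistHom p (rangeTwist d' α β h₁) (hβ.rangeTwist d' α h₁)) (twistHom p β hβ)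
      (twistHom p (rangeTwist d β γ h₂) (hγ.rangeTwist d β h₂)) (fun _ => rfl)
      (fun m => Subtype.ext (h₂ m)) (n + 1) n rfl
  rw [hid] at key
  rw [← cancel_mono (shift d' d h n), ← key]
  simp

end Twist

/-! ### The augmentation and homology in degree zero -/

section Augmentation

/-- The augmentation of the integral group ring. -/
noncomputable def augmentation : MonoidAlgebra ℤ G →+* ℤ :=
  (MonoidAlgebra.lift ℤ ℤ G (1 : G →* ℤ)).toRingHom

@[simp] theorem augmentation_of (g : G) : augmentation (MonoidAlgebra.of ℤ G g) = 1 := by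
  simp [augmentation]

@[simp] theorem augmentation_single (g : G) (n : ℤ) :
    augmentation (MonoidAlgebra.single g n) = n := by
  simp [augmentation]

variable {M : Type} [AddCommGroup M] [Module (MonoidAlgebra ℤ G) M]

theorem H0π_of_smul (g : G) (m : M) :
    H0π (rep (G := G) M) (MonoidAlgebra.of ℤ G g • m) = H0π (rep (G := G) M) m := by
  rw [← coinvariantsMk_comp_H0Iso_inv_apply, ← coinvariantsMk_comp_H0Iso_inv_apply]
  exact congrArg (H0Iso (rep (G := G) M)).inv (Representation.Coinvariants.mk_self_apply _ g m)

theorem H0π_smul (r : MonoidAlgebra ℤ G) (m : M) :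
    H0π (rep (G := G) M) (r • m) = augmentation r • H0π (rep (G := G) M) m := by
  induction r using MonoidAlgebra.induction_linear with
  | zero => simp
  | add f g hf hg => rw [add_smul, map_add, hf, hg, map_add, add_zsmul]
  | single g n =>
    have h : MonoidAlgebra.single g n = n • MonoidAlgebra.of ℤ G g := by simp
    rw [h, smul_assoc, map_zsmul, H0π_of_smul, map_zsmul, augmentation_of, smul_eq_mul, mul_one]

theorem H0π_surjective : Function.Surjective (H0π (rep (G := G) M)) :=
  (ModuleCat.epi_iff_surjective _).1 inferInstance

/-- An invariant functional is a morphism to the trivial representation `ℤ`, whose `H₀` is `ℤ`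
itself, so it factors through `H₀`. -/
theorem eq_zero_of_H0π_eq_zero (l : M →+ ℤ) (hl : ∀ g m, l (MonoidAlgebra.of ℤ G g • m) = l m)
    (m : M) (hm : H0π (rep (G := G) M) m = 0) : l m = 0 := by
  let φ : rep (G := G) M ⟶ Rep.trivial ℤ G ℤ :=
    Rep.ofHom ⟨l.toIntLinearMap, fun g => by ext m; exact hl g m⟩
  have h := H0π_map_apply (A := rep (G := G) M) (B := Rep.trivial ℤ G ℤ) (MonoidHom.id G) φ m
  rw [hm, map_zero] at h
  have h2 : (H0IsoOfIsTrivial (Rep.trivial ℤ G ℤ)).inv (l m) = 0 := h.symm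
  exact ((ModuleCat.mono_iff_injective (H0IsoOfIsTrivial (Rep.trivial ℤ G ℤ)).inv).1 inferInstance)
    (h2.trans (map_zero _).symm)

theorem augmentation_eq_zero_of_H0π_eq_zero (r : MonoidAlgebra ℤ G)
    (h : H0π (rep (G := G) (MonoidAlgebra ℤ G)) r = 0) : augmentation r = 0 :=
  eq_zero_of_H0π_eq_zero augmentation.toAddMonoidHom (fun g m => by simp) r h

end Augmentation

end GroupRing

/-! ### Homology of a module with a periodic resolution -/

namespace GroupRing

open groupHomology

variable {G : Type} [Group G]

/-- Right multiplication by an element of the group ring. -/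
noncomputable def mulRight (s : MonoidAlgebra ℤ G) :
    MonoidAlgebra ℤ G →ₗ[MonoidAlgebra ℤ G] MonoidAlgebra ℤ G :=
  LinearMap.toSpanSingleton _ _ s

@[simp] theorem mulRight_apply (s r : MonoidAlgebra ℤ G) : mulRight s r = r * s := rfl

/-- The left ideal generated by an element of the group ring. -/
noncomputable abbrev leftIdeal (s : MonoidAlgebra ℤ G) : Submodule (MonoidAlgebra ℤ G) (MonoidAlgebra ℤ G) :=
  LinearMap.range (mulRight s)

/-- A periodic free resolution, of period four and with ranks `1, 2, 2, 1`,
of the left ideal generated by `s`. -/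
structure PeriodicResolution (s : MonoidAlgebra ℤ G)
    (d₁ : MonoidAlgebra ℤ G × MonoidAlgebra ℤ G →ₗ[MonoidAlgebra ℤ G] MonoidAlgebra ℤ G)
    (d₂ : MonoidAlgebra ℤ G × MonoidAlgebra ℤ G →ₗ[MonoidAlgebra ℤ G]
      MonoidAlgebra ℤ G × MonoidAlgebra ℤ G)
    (d₃ : MonoidAlgebra ℤ G →ₗ[MonoidAlgebra ℤ G] MonoidAlgebra ℤ G × MonoidAlgebra ℤ G) :
    Prop where
  exact₀ : Function.Exact d₁ (mulRight s)
  exact₁ : Function.Exact d₂ d₁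
  exact₂ : Function.Exact d₃ d₂
  exact₃ : Function.Exact (mulRight s) d₃
  fst_augmentation : augmentation (d₃ 1).1 = 0
  snd_augmentation : augmentation (d₃ 1).2 = 0

variable {s : MonoidAlgebra ℤ G}
    {d₁ : MonoidAlgebra ℤ G × MonoidAlgebra ℤ G →ₗ[MonoidAlgebra ℤ G] MonoidAlgebra ℤ G}
    {d₂ : MonoidAlgebra ℤ G × MonoidAlgebra ℤ G →ₗ[MonoidAlgebra ℤ G]
      MonoidAlgebra ℤ G × MonoidAlgebra ℤ G}
    {d₃ : MonoidAlgebra ℤ G →ₗ[MonoidAlgebra ℤ G] MonoidAlgebra ℤ G × MonoidAlgebra ℤ G}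

theorem acyclic_sq : Acyclic G (MonoidAlgebra ℤ G × MonoidAlgebra ℤ G) :=
  acyclic_groupRing.prod acyclic_groupRing

theorem map_H0π {M N : Type} [AddCommGroup M] [Module (MonoidAlgebra ℤ G) M]
    [AddCommGroup N] [Module (MonoidAlgebra ℤ G) N] (d : M →ₗ[MonoidAlgebra ℤ G] N) (m : M) :
    homologyMap d 0 (H0π (rep (G := G) M) m) = H0π (rep (G := G) N) (d m) :=
  H0π_map_apply (A := rep (G := G) M) (B := rep (G := G) N) (MonoidHom.id G) (repHom d) m

theorem H0π_range_eq {Q : Type} [AddCommGroup Q] [Module (MonoidAlgebra ℤ G) Q]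
    (d : MonoidAlgebra ℤ G →ₗ[MonoidAlgebra ℤ G] Q) (r : MonoidAlgebra ℤ G) :
    H0π (rep (G := G) (LinearMap.range d)) (d.rangeRestrict r) =
      augmentation r • H0π (rep (G := G) (LinearMap.range d)) (d.rangeRestrict 1) := by
  rw [← H0π_smul, ← map_smul, smul_eq_mul, mul_one]

namespace PeriodicResolution

/-- The composite of connecting homomorphisms from the third homology of the resolved module. -/
noncomputable def dimShift (h : PeriodicResolution s d₁ d₂ d₃) :
    groupHomology (rep (G := G) (leftIdeal s)) 3 ⟶
      groupHomology (rep (G := G) (LinearMap.range d₃)) 0 :=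
  shift _ _ h.exact₀ 2 ≫ shift _ _ h.exact₁ 1 ≫ shift _ _ h.exact₂ 0

theorem mono_dimShift (h : PeriodicResolution s d₁ d₂ d₃) : Mono h.dimShift := by
  have := mono_shift _ _ h.exact₀ acyclic_groupRing 2
  have := mono_shift _ _ h.exact₁ acyclic_sq 1
  have := mono_shift _ _ h.exact₂ acyclic_sq 0
  unfold dimShift
  infer_instance

/-- The generator of the coinvariants of the last syzygy. -/
noncomputable def gen (_ : PeriodicResolution s d₁ d₂ d₃) :
    groupHomology (rep (G := G) (LinearMap.range d₃)) 0 :=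
  H0π (rep (G := G) (LinearMap.range d₃)) (d₃.rangeRestrict 1)

theorem exists_eq_zsmul_gen (h : PeriodicResolution s d₁ d₂ d₃)
    (y : groupHomology (rep (G := G) (LinearMap.range d₃)) 0) : ∃ n : ℤ, y = n • h.gen := by
  obtain ⟨m, rfl⟩ := H0π_surjective (G := G) y
  obtain ⟨r, rfl⟩ := d₃.surjective_rangeRestrict m
  exact ⟨_, H0π_range_eq d₃ r⟩

theorem augmentation_zsmul_gen (h : PeriodicResolution s d₁ d₂ d₃) :
    augmentation s • h.gen = 0 := by
  rw [gen, ← H0π_range_eq, show d₃.rangeRestrict s = 0 from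
    Subtype.ext ((h.exact₃ s).2 ⟨1, one_mul s⟩), map_zero]

theorem augmentation_zsmul_eq_zero (h : PeriodicResolution s d₁ d₂ d₃)
    (y : groupHomology (rep (G := G) (LinearMap.range d₃)) 0) : augmentation s • y = 0 := by
  obtain ⟨n, rfl⟩ := h.exists_eq_zsmul_gen y
  rw [zsmul_comm, h.augmentation_zsmul_gen, zsmul_zero]

/-- By right exactness of coinvariants, the kernel of `H₀(ℤ[G]) → H₀(range d₃)` comes from the ideal
generated by `s`, and every element of that ideal has augmentation divisible by that of `s`. -/
theorem augmentation_dvd_of_zsmul_gen (h : PeriodicResolution s d₁ d₂ d₃) {n : ℤ}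
    (hn : n • h.gen = 0) : augmentation s ∣ n := by
  have h₁ : homologyMap d₃.rangeRestrict 0
      (H0π (rep (G := G) (MonoidAlgebra ℤ G)) (n • (1 : MonoidAlgebra ℤ G))) = 0 := by
    rw [map_H0π, map_zsmul, map_zsmul]
    exact hn
  obtain ⟨x, hx⟩ := (ShortComplex.moduleCat_exact_iff _).1
    (mapShortComplex₂_exact (rangeSeq_shortExact _ _ h.exact₃) 0) _ h₁
  obtain ⟨m, rfl⟩ := H0π_surjective (G := G) x
  obtain ⟨r, rfl⟩ := (mulRight s).surjective_rangeRestrict m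
  have h₂ : H0π (rep (G := G) (MonoidAlgebra ℤ G)) (r * s) =
      H0π (rep (G := G) (MonoidAlgebra ℤ G)) (n • (1 : MonoidAlgebra ℤ G)) :=
    (map_H0π (LinearMap.range (mulRight s)).subtype ((mulRight s).rangeRestrict r)).symm.trans hx
  have h₃ := augmentation_eq_zero_of_H0π_eq_zero (r * s - n • (1 : MonoidAlgebra ℤ G)) (by
    rw [map_sub, h₂, sub_self])
  refine ⟨augmentation r, ?_⟩
  rw [map_sub, map_mul, map_zsmul, map_one, sub_eq_zero] at h₃
  rw [mul_comm, h₃, smul_eq_mul, mul_one]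

/-- Both coordinates of `d₃ 1` have augmentation zero, so the generator dies in `H₀` of the free
module and is hit by the last connecting map. The two earlier connecting maps are isomorphisms
because they join positive degrees. -/
theorem exists_dimShift_eq_gen (h : PeriodicResolution s d₁ d₂ d₃) :
    ∃ z, h.dimShift z = h.gen := by
  have := isIso_shift _ _ h.exact₀ acyclic_groupRing 1
  have := isIso_shift _ _ h.exact₁ acyclic_sq 0
  obtain ⟨z, hz⟩ := exists_shift_eq _ _ h.exact₂ h.gen (by
    rw [gen, map_H0π]
    have h1 : (LinearMap.range d₃).subtype (d₃.rangeRestrict 1) =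
        (d₃ 1).1 • ((1, 0) : MonoidAlgebra ℤ G × MonoidAlgebra ℤ G) +
          (d₃ 1).2 • ((0, 1) : MonoidAlgebra ℤ G × MonoidAlgebra ℤ G) := by
      ext <;> simp
    rw [h1, map_add, H0π_smul, H0π_smul, h.fst_augmentation, h.snd_augmentation, zero_smul,
      zero_smul, add_zero])
  obtain ⟨y, rfl⟩ := ((ModuleCat.epi_iff_surjective (shift _ _ h.exact₁ 1)).1 inferInstance) z
  obtain ⟨x, rfl⟩ := ((ModuleCat.epi_iff_surjective (shift _ _ h.exact₀ 2)).1 inferInstance) y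
  exact ⟨x, hz⟩

theorem isZero_four (h : PeriodicResolution s d₁ d₂ d₃) (hs : augmentation s ≠ 0) :
    Limits.IsZero (groupHomology (rep (G := G) (leftIdeal s)) 4) := by
  -- By periodicity the next connecting map embeds this group in `H₀` of the original ideal, with
  -- image in the kernel of the map to `H₀(ℤ[G])`. On augmentations that map is multiplication by
  -- the nonzero augmentation of `s`, so the kernel is trivial.
  have h₁ : Limits.IsZero (groupHomology (rep (G := G) (LinearMap.range d₃)) 1) := by
    have := mono_shift _ _ h.exact₃ acyclic_groupRing 0
    have hinj := (ModuleCat.mono_iff_injective (shift _ _ h.exact₃ 0)).1 inferInstance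
    rw [ModuleCat.isZero_iff_subsingleton]
    refine subsingleton_of_forall_eq 0 fun z => hinj ?_
    have hz := map_subtype_shift _ _ h.exact₃ z
    obtain ⟨m, hm⟩ := H0π_surjective (G := G) (shift _ _ h.exact₃ 0 z)
    obtain ⟨r, rfl⟩ := (mulRight s).surjective_rangeRestrict m
    rw [← hm, map_H0π] at hz
    have h2 := augmentation_eq_zero_of_H0π_eq_zero _ hz
    have h3 : augmentation r * augmentation s = 0 := by
      rw [← map_mul]
      exact h2
    rw [← hm, H0π_range_eq, (mul_eq_zero.1 h3).resolve_right hs, zero_smul, map_zero]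
  have := mono_shift _ _ h.exact₀ acyclic_groupRing 3
  have := mono_shift _ _ h.exact₁ acyclic_sq 2
  have := mono_shift _ _ h.exact₂ acyclic_sq 1
  exact h₁.of_mono (shift _ _ h.exact₀ 3 ≫ shift _ _ h.exact₁ 2 ≫ shift _ _ h.exact₂ 1)

/-- A semilinear endomorphism of the resolution acts trivially on the third homology. -/
theorem twistMap_three_eq_id (h : PeriodicResolution s d₁ d₂ d₃) {p : G →* G}
    (α : MonoidAlgebra ℤ G →+ MonoidAlgebra ℤ G)
    (β : MonoidAlgebra ℤ G × MonoidAlgebra ℤ G →+ MonoidAlgebra ℤ G × MonoidAlgebra ℤ G)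
    (hα : Semilinear p α) (hβ : Semilinear p β)
    (hαε : ∀ r, augmentation (α r) = augmentation r)
    (hs : ∀ r, mulRight s (α r) = α (mulRight s r))
    (h₁ : ∀ m, d₁ (β m) = α (d₁ m)) (h₂ : ∀ m, d₂ (β m) = β (d₂ m))
    (h₃ : ∀ r, d₃ (α r) = β (d₃ r)) :
    twistMap p (rangeTwist (mulRight s) α α hs) (hα.rangeTwist _ _ hs) 3 = 𝟙 _ := by
  refine twistMap_rangeTwist_eq_id _ _ h.exact₀ acyclic_groupRing β α α hα hα h₁ hs 2 ?_
  refine twistMap_rangeTwist_eq_id _ _ h.exact₁ acyclic_sq β β α hβ hα h₂ h₁ 1 ?_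
  refine twistMap_rangeTwist_eq_id _ _ h.exact₂ acyclic_sq α β β hβ hβ h₃ h₂ 0 ?_
  ext y
  obtain ⟨m, rfl⟩ := H0π_surjective (G := G) y
  obtain ⟨r, rfl⟩ := d₃.surjective_rangeRestrict m
  have h₄ : rangeTwist d₃ α β h₃ (d₃.rangeRestrict r) = d₃.rangeRestrict (α r) :=
    Subtype.ext (h₃ r).symm
  refine (H0π_map_apply (A := rep (G := G) (LinearMap.range d₃))
    (B := rep (G := G) (LinearMap.range d₃)) p (twistHom p _ (hβ.rangeTwist d₃ α h₃)) _).trans ?_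
  refine (congrArg (H0π (rep (G := G) (LinearMap.range d₃))) h₄).trans ?_
  -- The class of `d₃ r` in `H₀` depends only on the augmentation of `r`, which `α` preserves.
  rw [H0π_range_eq, hαε, ← H0π_range_eq]
  rfl

end PeriodicResolution

end GroupRing

/-! ### Norm elements of finite subgroups -/

namespace GroupRing

variable {G : Type} [Group G]

/-- The linear extension to the group ring of a function on the group. -/
noncomputable def linExt {M : Type} [AddCommGroup M] (F : G → M) : MonoidAlgebra ℤ G →ₗ[ℤ] M :=
  Finsupp.lift M ℤ G F ∘ₗ (MonoidAlgebra.coeffLinearEquiv ℤ).toLinearMap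

@[simp] theorem linExt_of {M : Type} [AddCommGroup M] (F : G → M) (g : G) :
    linExt F (MonoidAlgebra.of ℤ G g) = F g := by
  simp [linExt]

theorem linearMap_ext {M : Type} [AddCommGroup M] {p q : MonoidAlgebra ℤ G →ₗ[ℤ] M}
    (h : ∀ g, p (MonoidAlgebra.of ℤ G g) = q (MonoidAlgebra.of ℤ G g)) : p = q := by
  ext g
  exact h g

theorem eq_zero_of_zsmul_eq_zero {n : ℤ} (hn : n ≠ 0) {r : MonoidAlgebra ℤ G} (h : n • r = 0) :
    r = 0 := by
  ext g
  have h₁ : n * r.coeff g = 0 := congrArg (fun r => r.coeff g) h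
  exact (mul_eq_zero.1 h₁).resolve_left hn

section Norm

variable (C : Subgroup G) (s : Finset G) (hs : ∀ g, g ∈ s ↔ g ∈ C)

/-- A choice of representative of a left coset. -/
noncomputable def cosetRep (g : G) : G := (QuotientGroup.mk g : G ⧸ C).out

theorem cosetRep_inv_mul_mem (g : G) : (cosetRep C g)⁻¹ * g ∈ C := by
  rw [← QuotientGroup.eq]
  exact QuotientGroup.out_eq' _

theorem cosetRep_mul {c : G} (hc : c ∈ C) (g : G) : cosetRep C (g * c) = cosetRep C g := by
  unfold cosetRep
  rw [show (QuotientGroup.mk (g * c) : G ⧸ C) = QuotientGroup.mk g from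
    (QuotientGroup.eq.2 (by simpa using C.inv_mem hc))]

theorem cosetRep_cosetRep (g : G) : cosetRep C (cosetRep C g) = cosetRep C g := by
  have := cosetRep_mul C (C.inv_mem (cosetRep_inv_mul_mem C g)) g
  simpa using this

open Classical in
/-- The restriction of an element of the group ring to the chosen coset representatives. -/
noncomputable def restrictReps : MonoidAlgebra ℤ G →ₗ[ℤ] MonoidAlgebra ℤ G :=
  linExt fun g => if cosetRep C g = g then MonoidAlgebra.of ℤ G g else 0

/-- The map replacing each group element by its coset representative. -/
noncomputable def moveToReps : MonoidAlgebra ℤ G →ₗ[ℤ] MonoidAlgebra ℤ G :=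
  linExt fun g => MonoidAlgebra.of ℤ G (cosetRep C g)

/-- The sum in the group ring of a finite set of group elements. -/
noncomputable def normElt : MonoidAlgebra ℤ G := ∑ g ∈ s, MonoidAlgebra.of ℤ G g

variable {C s}
include hs

theorem of_mul_normElt {c : G} (hc : c ∈ C) : MonoidAlgebra.of ℤ G c * normElt s = normElt s := by
  rw [normElt, Finset.mul_sum]
  refine Finset.sum_nbij' (fun g => c * g) (fun g => c⁻¹ * g) ?_ ?_ ?_ ?_ ?_
  · intro g hg
    exact (hs _).2 (C.mul_mem hc ((hs g).1 hg))
  · intro g hg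
    exact (hs _).2 (C.mul_mem (C.inv_mem hc) ((hs g).1 hg))
  · intro g _
    simp
  · intro g _
    simp
  · intro g _
    rw [map_mul]

theorem moveToReps_mul_normElt (r : MonoidAlgebra ℤ G) :
    moveToReps C r * normElt s = r * normElt s := by
  suffices h : LinearMap.mulRight ℤ (normElt s) ∘ₗ moveToReps C =
      LinearMap.mulRight ℤ (normElt s) from LinearMap.congr_fun h r
  refine linearMap_ext fun g => ?_
  have h : g = cosetRep C g * ((cosetRep C g)⁻¹ * g) := by simp
  simp only [LinearMap.comp_apply, LinearMap.mulRight_apply, moveToReps, linExt_of]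
  conv_rhs => rw [h, map_mul, mul_assoc, of_mul_normElt hs (cosetRep_inv_mul_mem C g)]

/-- Multiplication by the norm element spreads each coset sum of coefficients evenly over the coset,
so it can be read off at the representative. -/
theorem restrictReps_mul_normElt (r : MonoidAlgebra ℤ G) :
    restrictReps C (r * normElt s) = moveToReps C r := by
  classical
  rw [← moveToReps_mul_normElt hs]
  suffices h : restrictReps C ∘ₗ LinearMap.mulRight ℤ (normElt s) ∘ₗ moveToReps C =
      moveToReps C from LinearMap.congr_fun h r
  refine linearMap_ext fun g => ?_
  simp only [LinearMap.comp_apply, LinearMap.mulRight_apply, moveToReps, linExt_of]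
  rw [normElt, Finset.mul_sum, map_sum, Finset.sum_eq_single 1]
  · rw [map_one, mul_one, restrictReps, linExt_of, if_pos (cosetRep_cosetRep C g)]
  · intro c hc hc1
    rw [← map_mul, restrictReps, linExt_of, cosetRep_mul C ((hs c).1 hc), cosetRep_cosetRep,
      if_neg (by simpa using hc1)]
  · intro h
    exact absurd ((hs 1).2 C.one_mem) h

/-- Modulo the span every group element equals its coset representative, and
`restrictReps_mul_normElt` shows that moving `r` to the representatives gives zero. -/
theorem mem_span_of_mul_normElt_eq_zero {r : MonoidAlgebra ℤ G} (hr : r * normElt s = 0) :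
    r ∈ Ideal.span {z | ∃ c ∈ C, z = MonoidAlgebra.of ℤ G c - 1} := by
  have h₀ : moveToReps C r = 0 := by rw [← restrictReps_mul_normElt hs, hr, map_zero]
  suffices h : ∀ q, q - moveToReps C q ∈
      Ideal.span {z | ∃ c ∈ C, z = MonoidAlgebra.of ℤ G c - 1} by
    simpa [h₀] using h r
  intro q
  induction q using MonoidAlgebra.induction_linear with
  | zero => simp
  | add p q hp hq =>
    rw [map_add, add_sub_add_comm]
    exact add_mem hp hq
  | single g n =>
    have h : MonoidAlgebra.single g n = n • MonoidAlgebra.of ℤ G g := by simp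
    rw [h, map_zsmul, ← smul_sub]
    refine zsmul_mem ?_ n
    rw [moveToReps, linExt_of]
    have h : g = cosetRep C g * ((cosetRep C g)⁻¹ * g) := by simp
    have h2 : MonoidAlgebra.of ℤ G g - MonoidAlgebra.of ℤ G (cosetRep C g) =
        MonoidAlgebra.of ℤ G (cosetRep C g) *
          (MonoidAlgebra.of ℤ G ((cosetRep C g)⁻¹ * g) - 1) := by
      rw [mul_sub, ← map_mul, ← h, mul_one]
    rw [h2]
    exact Ideal.mul_mem_left _ _ (Ideal.subset_span ⟨_, cosetRep_inv_mul_mem C g, rfl⟩)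

/-- The restriction of `r` to the coset representatives is the quotient. The identity is first
obtained after multiplication by the order of `C`, which cancels because the group ring is
torsion-free. -/
theorem exists_eq_mul_normElt {r : MonoidAlgebra ℤ G}
    (hr : ∀ c ∈ C, r * MonoidAlgebra.of ℤ G c = r) : ∃ q, r = q * normElt s := by
  have h₁ : r * normElt s = (s.card : ℤ) • r := by
    rw [normElt, Finset.mul_sum, Finset.sum_congr rfl fun c hc => hr c ((hs c).1 hc),
      Finset.sum_const, natCast_zsmul]
  have h₂ := moveToReps_mul_normElt hs r
  rw [← restrictReps_mul_normElt hs, h₁, map_zsmul, smul_mul_assoc] at h₂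
  refine ⟨restrictReps C r, (sub_eq_zero.1 (eq_zero_of_zsmul_eq_zero (n := s.card) ?_ ?_)).symm⟩
  · have : 0 < s.card := Finset.card_pos.2 ⟨1, (hs 1).2 C.one_mem⟩
    omega
  · rw [smul_sub, h₂, sub_self]

end Norm

end GroupRing

/-! ### Exactness of the quaternionic resolution, by ring identities -/

/-- Elements `x`, `y` of a ring, with a partial sum `σ` and a full sum `N` of the powers of `x`,
that behave like standard generators of a generalized quaternion group in a group ring. -/
structure QuaternionRelations {R : Type} [Ring R] (x y z σ N : R) : Prop where
  sq : y * y = z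
  conj : x * y * x = y
  z_sq : z * z = 1
  z_x : z * x = x * z
  z_σ : z * σ = σ * z
  σ_x : σ * x = x * σ
  N_x : N * x = N
  x_N : x * N = N
  y_N : y * N = N * y
  σ_sub : σ * (x - 1) = z - 1
  σ_add : σ * (1 + z) = N
  y_σ : z * y * σ = x * σ * y
  eq_mul_N : ∀ r, r * x = r → ∃ s, r = s * N
  of_mul_N : ∀ r, r * N = 0 → ∃ s, r = s * (x - 1)
  eq_mul_norm : ∀ r, r * x = r → r * y = r → ∃ s, r = s * (N * (1 + y))
  of_mul_norm : ∀ r, r * (N * (1 + y)) = 0 → ∃ u v, r = u * (x - 1) + v * (y - 1)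
  of_two : ∀ r : R, r + r = 0 → r = 0

namespace QuaternionRelations

variable {R : Type} [Ring R] {x y z σ N : R} (h : QuaternionRelations x y z σ N)

include h

theorem y_z : y * z = z * y := by rw [← h.sq, mul_assoc]

theorem N_z : N * z = N := by
  have h1 := h.σ_add
  have h2 := h.z_sq
  rw [← h1, mul_assoc, add_mul, h2, one_mul, add_comm]

theorem z_N : z * N = N := by
  rw [← h.σ_add, ← mul_assoc, h.z_σ, mul_assoc, mul_add, mul_one, h.z_sq, add_comm]

theorem x_norm : x * (N * (1 + y)) = N * (1 + y) := by
  rw [← mul_assoc, h.x_N]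

theorem y_norm : y * (N * (1 + y)) = N * (1 + y) := by
  have h1 := h.y_N
  have h2 := h.sq
  have h3 := h.N_z
  linear_combination (norm := noncomm_ring) h1 * (1 + y) + N * h2 + h3

theorem exact₀ (r : R) : r * (N * (1 + y)) = 0 ↔ ∃ u v, u * (x - 1) + v * (y - 1) = r := by
  constructor
  · intro hr
    obtain ⟨u, v, rfl⟩ := h.of_mul_norm r hr
    exact ⟨u, v, rfl⟩
  · rintro ⟨u, v, rfl⟩
    have h1 := h.x_N
    have h2 := h.y_N
    have h3 := h.N_z
    have h4 := h.sq
    linear_combination (norm := noncomm_ring) u * h1 * (1 + y) + v * h2 * (1 + y) + v * N * h4 +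
      v * h3

theorem exact₁ (u v : R) : u * (x - 1) + v * (y - 1) = 0 ↔
    ∃ p q, p * σ + q * (1 + x * y) = u ∧ -(p * (1 + y)) + q * (x - 1) = v := by
  constructor
  · intro huv
    have h1 := h.x_N
    have h2 := h.y_N
    -- Multiplying by `N` kills the `x`-term, so `v * N` is invariant under both generators and
    -- hence a multiple of the full norm.
    have hN : v * N * y = v * N := by
      linear_combination (norm := noncomm_ring) huv * N - v * h2 - u * h1
    obtain ⟨s, hs⟩ := h.eq_mul_norm (v * N) (by rw [mul_assoc, h.N_x]) hN
    obtain ⟨r, hr⟩ := h.of_mul_N (v - s * (1 + y)) (by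
      linear_combination (norm := noncomm_ring) hs - s * h2)
    obtain ⟨k, hk⟩ := h.eq_mul_N (u + s * σ - r * (1 + x * y)) (by
      have h3 := h.σ_sub
      have h4 := h.sq
      have h5 := h.conj
      linear_combination (norm := noncomm_ring) huv + s * h3 - hr * (y - 1) - s * h4 - r * h5)
    have h6 := h.y_σ
    have h7 := h.σ_add
    have h8 := h.z_sq
    have h9 := h.sq
    have h10 := h.z_N
    have h11 := h.σ_x
    have h12 := h.σ_sub
    have h13 := h.z_x
    have h14 := h.z_σ
    have h15 : y * σ + σ * x * y = y * N := by
      linear_combination (norm := noncomm_ring) z * h6 - h8 * y * σ + h13 * σ * y + x * h14 * y +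
        h11 * y + x * h7 * y + h1 * y - h2
    -- The pair `(k * y * (y - 1), k * y * σ)` maps to `(k * N, 0)` and so absorbs the error term `k
    -- * N`.
    refine ⟨k * y * (y - 1) - s, k * y * σ + r, ?_, ?_⟩
    · linear_combination (norm := noncomm_ring) k * y * h15 - hk + k * h10 + k * h9 * N
    · linear_combination (norm := noncomm_ring) -hr + k * y * h12 - k * y * h9
  · rintro ⟨p, q, rfl, rfl⟩
    have h3 := h.σ_sub
    have h4 := h.sq
    have h5 := h.conj
    linear_combination (norm := noncomm_ring) p * h3 - p * h4 + q * h5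

theorem exact₂ (p q : R) : (p * σ + q * (1 + x * y) = 0 ∧ -(p * (1 + y)) + q * (x - 1) = 0) ↔
    ∃ r, r * (x - 1) = p ∧ r * (1 - x * y) = q := by
  constructor
  · rintro ⟨h1, h2⟩
    have h3 := h.σ_add
    have h4 := h.sq
    have h5 := h.conj
    have h6 := h.N_x
    have h7 := h.x_N
    have h8 := h.y_N
    have h9 := h.z_sq
    have hpN : p * N = -(q * (1 + x * y) * (1 + z)) := by
      linear_combination (norm := noncomm_ring) h1 * (1 + z) - p * h3
    have hw : x * y * (x * y) = z := by rw [← mul_assoc, h5, h4]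
    have hzw : z * (x * y) = x * y * z := by
      rw [← mul_assoc, h.z_x, mul_assoc, ← h.y_z, mul_assoc]
    -- The factor `(1 + x * y) * (1 + z)` is the norm of the cyclic group of order four generated by
    -- `x * y`, so `p * N` is fixed by `x * y` and therefore by `y`. The second equation gives `p *
    -- N * y = -(p * N)`, whence `2 * p * N = 0`.
    have hpy : p * N * y = p * N := by
      have ha : p * N * (x * y) = p * N := by
        rw [hpN]
        linear_combination (norm := noncomm_ring) -q * hw - q * hw * z - q * h9 - q * hzw - q * x * y * hzw
      linear_combination (norm := noncomm_ring) ha - p * h6 * y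
    have hp0 : p * N = 0 := h.of_two _ (by
      linear_combination (norm := noncomm_ring) -hpy - h2 * N - p * h8 + q * h7)
    obtain ⟨r, rfl⟩ := h.of_mul_N p hp0
    obtain ⟨s, hs⟩ := h.eq_mul_N (q - r * (1 - x * y)) (by
      linear_combination (norm := noncomm_ring) h2 + r * h5)
    have hs0 : s * (N * (1 + y)) = 0 := by
      have hq : s * N * (1 + x * y) = 0 := by
        rw [← hs]
        have h12 := h.σ_sub
        have h11 := h.σ_x
        linear_combination (norm := noncomm_ring) h1 - r * h12 + r * h11 + r * hw
      linear_combination (norm := noncomm_ring) hq - s * h6 * y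
    obtain ⟨u, v, rfl⟩ := h.of_mul_norm s hs0
    -- Subtracting `v * N` leaves the first coordinate unchanged, since `N * (x - 1) = 0`, and
    -- corrects the second by `s * N = v * N * (y - 1)`.
    refine ⟨r - v * N, ?_, ?_⟩
    · linear_combination (norm := noncomm_ring) - v * h6
    · linear_combination (norm := noncomm_ring) v * h6 * y - hs - u * h7 - v * h8
  · rintro ⟨r, rfl, rfl⟩
    have h3 := h.σ_sub
    have h4 := h.sq
    have h5 := h.conj
    have h11 := h.σ_x
    constructor
    · linear_combination (norm := noncomm_ring) r * h3 - r * h11 - r * h5 * y - r * h4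
    · linear_combination (norm := noncomm_ring) -r * h5

theorem exact₃ (r : R) : (r * (x - 1) = 0 ∧ r * (1 - x * y) = 0) ↔
    ∃ s, s * (N * (1 + y)) = r := by
  constructor
  · rintro ⟨h1, h2⟩
    have hx : r * x = r := by
      linear_combination (norm := noncomm_ring) h1
    obtain ⟨s, rfl⟩ := h.eq_mul_norm r hx (by
      linear_combination (norm := noncomm_ring) -h1 * y - h2)
    exact ⟨s, rfl⟩
  · rintro ⟨s, rfl⟩
    have h4 := h.sq
    have h6 := h.N_x
    have h8 := h.y_N
    have h13 := h.N_z
    constructor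
    · linear_combination (norm := noncomm_ring) s * h6 + s * y * h6 - s * h8 * x + s * h8
    · linear_combination (norm := noncomm_ring) - s * h6 * y - s * y * h6 * y + s * h8 * x * y - s * h8 * y  - s * N * h4 - s * h13

end QuaternionRelations

/-! ### Generalized quaternion subgroups and their norm elements -/

/-- Elements generating a generalized quaternion group of order `4 * m`. -/
structure QuaternionPair {G : Type} [Group G] (x y : G) (m : ℕ) : Prop where
  pow_eq : x ^ m = y * y
  conj : x * y * x = y
  orderOf_eq : orderOf x = 2 * m
  two_le : 2 ≤ m

namespace QuaternionPair

open GroupRing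

variable {G : Type} [Group G] {x y : G} {m : ℕ} (h : QuaternionPair x y m)

include h

theorem conj_mem {g : G} (hg : g ∈ Subgroup.zpowers x) : y * g * y⁻¹ ∈ Subgroup.zpowers x := by
  obtain ⟨k, rfl⟩ := hg
  refine ⟨-k, ?_⟩
  have h1 : y * x * y⁻¹ = x⁻¹ := by
    rw [mul_inv_eq_iff_eq_mul, eq_inv_mul_iff_mul_eq, ← mul_assoc, h.conj]
  simp only
  rw [← conj_zpow, h1, inv_zpow, zpow_neg]

theorem sq_mem : y * y ∈ Subgroup.zpowers x := by
  rw [← h.pow_eq]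
  exact Subgroup.npow_mem_zpowers x m

theorem notMem_zpowers : y ∉ Subgroup.zpowers x := by
  rintro ⟨k, hk⟩
  have h1 : Commute x y := by
    rw [← hk]
    exact (Commute.refl x).zpow_right k
  have h2 : x ^ 2 = 1 := by
    have := h.conj
    rw [h1.eq, mul_assoc, mul_eq_left] at this
    rw [pow_two, this]
  have h3 := Nat.le_of_dvd (by norm_num) (orderOf_dvd_of_pow_eq_one h2)
  have := h.two_le
  rw [h.orderOf_eq] at h3
  omega

/-- The generalized quaternion subgroup generated by `x` and `y`. -/
def subgroup : Subgroup G where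
  carrier := {g | g ∈ Subgroup.zpowers x ∨ g * y⁻¹ ∈ Subgroup.zpowers x}
  one_mem' := Or.inl (one_mem _)
  mul_mem' := by
    rintro a b (ha | ha) (hb | hb)
    · exact Or.inl (mul_mem ha hb)
    · right
      rw [mul_assoc]
      exact mul_mem ha hb
    · right
      have := mul_mem ha (h.conj_mem hb)
      rwa [show a * y⁻¹ * (y * b * y⁻¹) = a * b * y⁻¹ by group] at this
    · left
      have := mul_mem (mul_mem ha (h.conj_mem hb)) h.sq_mem
      rwa [show a * y⁻¹ * (y * (b * y⁻¹) * y⁻¹) * (y * y) = a * b by group] at this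
  inv_mem' := by
    rintro a (ha | ha)
    · exact Or.inl (inv_mem ha)
    · right
      have := mul_mem (inv_mem h.sq_mem) (h.conj_mem (inv_mem ha))
      rwa [show (y * y)⁻¹ * (y * (a * y⁻¹)⁻¹ * y⁻¹) = a⁻¹ * y⁻¹ by group] at this

omit h in
/-- The sum of the first `n` powers of a group element in the group ring. -/
noncomputable def _root_.GroupRing.powSum (x : G) (n : ℕ) : MonoidAlgebra ℤ G :=
  ∑ i ∈ Finset.range n, MonoidAlgebra.of ℤ G x ^ i

open Classical in
omit h in
/-- The finite set of powers of `x`. -/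
noncomputable def powers (x : G) : Finset G := (Finset.range (orderOf x)).image (x ^ ·)

open Classical in
omit h in
/-- The finite set underlying the generalized quaternion subgroup. -/
noncomputable def elements (x y : G) : Finset G := powers x ∪ (powers x).image (· * y)

theorem mem_powers (g : G) : g ∈ powers x ↔ g ∈ Subgroup.zpowers x := by
  have h1 : IsOfFinOrder x := orderOf_pos_iff.1 (by
    have := h.two_le
    rw [h.orderOf_eq]
    omega)
  classical
  rw [h1.mem_zpowers_iff_mem_range_orderOf, powers]

theorem mem_elements (g : G) : g ∈ elements x y ↔ g ∈ h.subgroup := by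
  change _ ↔ g ∈ Subgroup.zpowers x ∨ g * y⁻¹ ∈ Subgroup.zpowers x
  classical
  simp only [elements, Finset.mem_union, h.mem_powers, Finset.mem_image]
  refine or_congr Iff.rfl ⟨?_, fun hg => ⟨_, hg, by group⟩⟩
  rintro ⟨b, hb, rfl⟩
  simpa using hb

theorem normElt_powers : normElt (powers x) = powSum x (2 * m) := by
  classical
  rw [normElt, powers, Finset.sum_image, powSum, h.orderOf_eq]
  · simp only [map_pow]
  · intro i hi j hj hij
    exact pow_injOn_Iio_orderOf (by simpa using hi) (by simpa using hj) hij

theorem normElt_elements :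
    normElt (elements x y) = powSum x (2 * m) * (1 + MonoidAlgebra.of ℤ G y) := by
  classical
  rw [← h.normElt_powers, elements, normElt, Finset.sum_union, Finset.sum_image, mul_add, mul_one,
    normElt, Finset.sum_mul]
  · simp only [map_mul]
  · intro a _ b _ hab
    exact mul_right_cancel hab
  · rw [Finset.disjoint_left]
    intro g hg hg'
    obtain ⟨b, hb, rfl⟩ := Finset.mem_image.1 hg'
    rw [h.mem_powers] at hg hb
    have := mul_mem (inv_mem hb) hg
    exact h.notMem_zpowers (by simpa using this)

omit h in
theorem exists_pow_of_mem_powers {g : G} (hg : g ∈ powers x) :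
    ∃ k : ℕ, MonoidAlgebra.of ℤ G g = MonoidAlgebra.of ℤ G x ^ k := by
  classical
  obtain ⟨k, -, rfl⟩ := Finset.mem_image.1 hg
  exact ⟨k, map_pow _ _ _⟩

omit h in
theorem _root_.mul_pow_eq_self {R : Type} [Monoid R] {r a : R} (hr : r * a = r) (k : ℕ) :
    r * a ^ k = r := by
  induction k with
  | zero => simp
  | succ k ih => rw [pow_succ, ← mul_assoc, ih, hr]

theorem eq_mul_of_mul_eq (r : MonoidAlgebra ℤ G) (hr : r * MonoidAlgebra.of ℤ G x = r) :
    ∃ s, r = s * powSum x (2 * m) := by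
  rw [← h.normElt_powers]
  refine exists_eq_mul_normElt h.mem_powers fun c hc => ?_
  obtain ⟨k, hk⟩ := exists_pow_of_mem_powers ((h.mem_powers c).2 hc)
  rw [hk, mul_pow_eq_self hr]

theorem eq_mul_of_mul_eq₂ (r : MonoidAlgebra ℤ G) (hx : r * MonoidAlgebra.of ℤ G x = r)
    (hy : r * MonoidAlgebra.of ℤ G y = r) :
    ∃ s, r = s * (powSum x (2 * m) * (1 + MonoidAlgebra.of ℤ G y)) := by
  rw [← h.normElt_elements]
  refine exists_eq_mul_normElt h.mem_elements fun c hc => ?_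
  rcases hc with hc | hc <;> obtain ⟨k, hk⟩ := exists_pow_of_mem_powers ((h.mem_powers _).2 hc)
  · rw [hk, mul_pow_eq_self hx]
  · rw [← inv_mul_cancel_right c y, map_mul, hk, ← mul_assoc, mul_pow_eq_self hx, hy]

theorem eq_mul_of_mul_powSum (r : MonoidAlgebra ℤ G) (hr : r * powSum x (2 * m) = 0) :
    ∃ s, r = s * (MonoidAlgebra.of ℤ G x - 1) := by
  rw [← h.normElt_powers] at hr
  have h1 := mem_span_of_mul_normElt_eq_zero h.mem_powers hr
  have h2 : r ∈ Ideal.span {MonoidAlgebra.of ℤ G x - 1} := by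
    refine Ideal.span_le.2 ?_ h1
    rintro _ ⟨c, hc, rfl⟩
    obtain ⟨k, hk⟩ := exists_pow_of_mem_powers ((h.mem_powers c).2 hc)
    rw [hk, ← geom_sum_mul]
    exact Ideal.mul_mem_left _ _ (Ideal.subset_span rfl)
  obtain ⟨s, hs⟩ := Ideal.mem_span_singleton'.1 h2
  exact ⟨s, hs.symm⟩

theorem eq_add_of_mul_norm (r : MonoidAlgebra ℤ G)
    (hr : r * (powSum x (2 * m) * (1 + MonoidAlgebra.of ℤ G y)) = 0) :
    ∃ u v, r = u * (MonoidAlgebra.of ℤ G x - 1) + v * (MonoidAlgebra.of ℤ G y - 1) := by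
  rw [← h.normElt_elements] at hr
  have h1 := mem_span_of_mul_normElt_eq_zero h.mem_elements hr
  have h2 : r ∈ Ideal.span {MonoidAlgebra.of ℤ G x - 1, MonoidAlgebra.of ℤ G y - 1} := by
    refine Ideal.span_le.2 ?_ h1
    have h3 : ∀ k : ℕ, MonoidAlgebra.of ℤ G x ^ k - 1 ∈
        Ideal.span {MonoidAlgebra.of ℤ G x - 1, MonoidAlgebra.of ℤ G y - 1} := fun k => by
      rw [← geom_sum_mul]
      exact Ideal.mul_mem_left _ _ (Ideal.subset_span (Or.inl rfl))
    rintro _ ⟨c, hc, rfl⟩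
    rcases hc with hc | hc <;> obtain ⟨k, hk⟩ := exists_pow_of_mem_powers ((h.mem_powers _).2 hc)
    · rw [hk]
      exact h3 k
    · rw [← inv_mul_cancel_right c y, map_mul, hk, show ∀ a b : MonoidAlgebra ℤ G,
        a * b - 1 = a * (b - 1) + (a - 1) from fun a b => by noncomm_ring]
      exact add_mem (Ideal.mul_mem_left _ _ (Ideal.subset_span (Or.inr rfl))) (h3 k)
  obtain ⟨u, v, huv⟩ := Submodule.mem_span_pair.1 h2
  exact ⟨u, v, huv.symm⟩

omit h in
-- Moving `y` past a power of `x` inverts that power, so the sum is merely listed in reverse order.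
-- The induction avoids inverses of `x`.
theorem _root_.pow_mul_mul_geom_sum {R : Type} [Ring R] {x y : R} (hxy : x * y * x = y) (k : ℕ) :
    x ^ k * y * ∑ i ∈ Finset.range k, x ^ i = x * (∑ i ∈ Finset.range k, x ^ i) * y := by
  have h1 : ∀ k : ℕ, x ^ k * y * x ^ k = y := fun k => by
    induction k with
    | zero => simp
    | succ k ih =>
      calc x ^ (k + 1) * y * x ^ (k + 1) = x ^ k * (x * y * x) * x ^ k := by
            rw [pow_succ x k]
            nth_rewrite 2 [← pow_succ]
            rw [pow_succ']
            simp only [mul_assoc]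
        _ = y := by rw [hxy, ih]
  induction k with
  | zero => simp
  | succ k ih =>
    have h3 : ∑ i ∈ Finset.range (k + 1), x ^ i = x * ∑ i ∈ Finset.range k, x ^ i + 1 :=
      geom_sum_succ
    have h4 : ∑ i ∈ Finset.range (k + 1), x ^ i = ∑ i ∈ Finset.range k, x ^ i + x ^ k :=
      Finset.sum_range_succ _ _
    nth_rewrite 1 [h4]
    rw [h3]
    have h5 := congrArg (x * ·) ih
    have h6 := congrArg (x * ·) (h1 k)
    rw [pow_succ']
    linear_combination (norm := noncomm_ring) h5 + h6

theorem relations : QuaternionRelations (MonoidAlgebra.of ℤ G x) (MonoidAlgebra.of ℤ G y)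
    (MonoidAlgebra.of ℤ G x ^ m) (powSum x m) (powSum x (2 * m)) where
  sq := by rw [← map_mul, ← h.pow_eq, map_pow]
  conj := by rw [← map_mul, ← map_mul, h.conj]
  z_sq := by rw [← pow_add, ← map_pow, ← two_mul, ← h.orderOf_eq, pow_orderOf_eq_one, map_one]
  z_x := (Commute.refl _).pow_left m
  z_σ := (Commute.sum_right _ _ _ fun i _ => (Commute.refl _).pow_pow m i)
  σ_x := (Commute.sum_left _ _ _ fun i _ => (Commute.refl _).pow_left i)
  N_x := by
    have h1 := geom_sum_mul (MonoidAlgebra.of ℤ G x) (2 * m)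
    rw [← map_pow, ← h.orderOf_eq, pow_orderOf_eq_one, map_one, sub_self, mul_sub, mul_one,
      sub_eq_zero, h.orderOf_eq] at h1
    exact h1
  x_N := by
    have h1 := mul_geom_sum (MonoidAlgebra.of ℤ G x) (2 * m)
    rw [← map_pow, ← h.orderOf_eq, pow_orderOf_eq_one, map_one, sub_self, sub_mul, one_mul,
      sub_eq_zero, h.orderOf_eq] at h1
    exact h1
  y_N := by
    have h1 := pow_mul_mul_geom_sum (x := MonoidAlgebra.of ℤ G x) (y := MonoidAlgebra.of ℤ G y)
      (by rw [← map_mul, ← map_mul, h.conj]) (2 * m)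
    have h2 := mul_geom_sum (MonoidAlgebra.of ℤ G x) (2 * m)
    rw [← map_pow, ← h.orderOf_eq, pow_orderOf_eq_one, map_one, sub_self, sub_mul, one_mul,
      sub_eq_zero] at h2
    rwa [← map_pow, ← h.orderOf_eq, pow_orderOf_eq_one, map_one, one_mul, h2, h.orderOf_eq] at h1
  σ_sub := geom_sum_mul _ _
  σ_add := by
    rw [powSum, powSum, two_mul, Finset.sum_range_add, mul_add, mul_one, Finset.sum_mul]
    simp only [← pow_add, add_comm]
  y_σ := pow_mul_mul_geom_sum (by rw [← map_mul, ← map_mul, h.conj]) m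
  eq_mul_N := h.eq_mul_of_mul_eq
  of_mul_N := h.eq_mul_of_mul_powSum
  eq_mul_norm := h.eq_mul_of_mul_eq₂
  of_mul_norm := h.eq_add_of_mul_norm
  of_two r hr := eq_zero_of_zsmul_eq_zero (n := 2) two_ne_zero (by rw [two_zsmul, hr])

end QuaternionPair

/-! ### The induced resolution and its semilinear symmetries -/

namespace GroupRing

variable {G : Type} [Group G]

section Differentials

variable (x y : G)

/-- The first differential of the quaternionic resolution. -/
noncomputable def quatD₁ :
    MonoidAlgebra ℤ G × MonoidAlgebra ℤ G →ₗ[MonoidAlgebra ℤ G] MonoidAlgebra ℤ G :=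
  (mulRight (MonoidAlgebra.of ℤ G x - 1)).coprod (mulRight (MonoidAlgebra.of ℤ G y - 1))

/-- The second differential of the quaternionic resolution. -/
noncomputable def quatD₂ (m : ℕ) : MonoidAlgebra ℤ G × MonoidAlgebra ℤ G →ₗ[MonoidAlgebra ℤ G]
    MonoidAlgebra ℤ G × MonoidAlgebra ℤ G :=
  ((mulRight (powSum x m)).coprod
    (mulRight (1 + MonoidAlgebra.of ℤ G x * MonoidAlgebra.of ℤ G y))).prod
  ((-mulRight (1 + MonoidAlgebra.of ℤ G y)).coprod (mulRight (MonoidAlgebra.of ℤ G x - 1)))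

/-- The third differential of the quaternionic resolution. -/
noncomputable def quatD₃ :
    MonoidAlgebra ℤ G →ₗ[MonoidAlgebra ℤ G] MonoidAlgebra ℤ G × MonoidAlgebra ℤ G :=
  (mulRight (MonoidAlgebra.of ℤ G x - 1)).prod
    (mulRight (1 - MonoidAlgebra.of ℤ G x * MonoidAlgebra.of ℤ G y))

/-- The norm element of the generalized quaternion group generated by `x` and `y`. -/
noncomputable def quatNorm (m : ℕ) : MonoidAlgebra ℤ G :=
  powSum x (2 * m) * (1 + MonoidAlgebra.of ℤ G y)

theorem augmentation_quatNorm (m : ℕ) : augmentation (quatNorm x y m) = 4 * m := by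
  simp [quatNorm, powSum, -MonoidAlgebra.of_apply]
  ring

theorem _root_.QuaternionPair.periodicResolution {x y : G} {m : ℕ} (h : QuaternionPair x y m) :
    PeriodicResolution (quatNorm x y m) (quatD₁ x y) (quatD₂ x y m) (quatD₃ x y) where
  exact₀ r := (h.relations.exact₀ r).trans
    ⟨fun ⟨u, v, huv⟩ => ⟨(u, v), huv⟩, fun ⟨u, hu⟩ => ⟨u.1, u.2, hu⟩⟩
  exact₁ r := (h.relations.exact₁ r.1 r.2).trans
    ⟨fun ⟨u, v, h₁, h₂⟩ => ⟨(u, v), Prod.ext h₁ h₂⟩,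
      fun ⟨u, hu⟩ => ⟨u.1, u.2, congrArg Prod.fst hu, congrArg Prod.snd hu⟩⟩
  exact₂ r := Prod.ext_iff.trans <| (h.relations.exact₂ r.1 r.2).trans
    ⟨fun ⟨u, h₁, h₂⟩ => ⟨u, Prod.ext h₁ h₂⟩,
      fun ⟨u, hu⟩ => ⟨u, congrArg Prod.fst hu, congrArg Prod.snd hu⟩⟩
  exact₃ r := Prod.ext_iff.trans (h.relations.exact₃ r)
  fst_augmentation := by simp [quatD₃, -MonoidAlgebra.of_apply]
  snd_augmentation := by simp [quatD₃, -MonoidAlgebra.of_apply]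

end Differentials

section Twist

variable (p : G →* G) (c : G)

/-- The endomorphism of the group ring induced by an endomorphism of the group, followed by right
multiplication by a group element. -/
noncomputable def mulTwist : MonoidAlgebra ℤ G →+ MonoidAlgebra ℤ G :=
  (AddMonoidHom.mulRight (MonoidAlgebra.of ℤ G c)).comp
    (MonoidAlgebra.mapDomainRingHom ℤ p).toAddMonoidHom

theorem mulTwist_apply (r : MonoidAlgebra ℤ G) :
    mulTwist p c r = MonoidAlgebra.mapDomainRingHom ℤ p r * MonoidAlgebra.of ℤ G c := rfl

@[simp] theorem mapDomainRingHom_of (g : G) : MonoidAlgebra.mapDomainRingHom ℤ p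
    (MonoidAlgebra.of ℤ G g) = MonoidAlgebra.of ℤ G (p g) := by
  simp

theorem augmentation_mapDomainRingHom (r : MonoidAlgebra ℤ G) :
    augmentation (MonoidAlgebra.mapDomainRingHom ℤ p r) = augmentation r := by
  have h : (augmentation.comp (MonoidAlgebra.mapDomainRingHom ℤ p)).toAddMonoidHom.toIntLinearMap =
      (augmentation (G := G)).toAddMonoidHom.toIntLinearMap :=
    linearMap_ext fun g => (congrArg augmentation (mapDomainRingHom_of p g)).trans
      ((augmentation_of _).trans (augmentation_of g).symm)
  exact LinearMap.congr_fun h r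

theorem augmentation_mulTwist (r : MonoidAlgebra ℤ G) :
    augmentation (mulTwist p c r) = augmentation r := by
  rw [mulTwist_apply, map_mul, augmentation_of, mul_one, augmentation_mapDomainRingHom]

theorem semilinear_mulTwist : Semilinear p (mulTwist p c) := fun g m => by
  rw [mulTwist_apply, smul_eq_mul, map_mul, mapDomainRingHom_of, mul_assoc]
  rfl

/-- The elements on which the twist agrees with right multiplication. -/
def twistFixed : Subring (MonoidAlgebra ℤ G) where
  carrier := {e | MonoidAlgebra.mapDomainRingHom ℤ p e * MonoidAlgebra.of ℤ G c =
    MonoidAlgebra.of ℤ G c * e}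
  one_mem' := by simp [-MonoidAlgebra.of_apply]
  zero_mem' := by simp
  neg_mem' {e} he := by
    rw [Set.mem_ofPred_eq] at he ⊢
    rw [map_neg, neg_mul, he, mul_neg]
  add_mem' {e e'} he he' := by
    rw [Set.mem_ofPred_eq] at he he' ⊢
    rw [map_add, add_mul, he, he', mul_add]
  mul_mem' {e e'} he he' := by
    rw [Set.mem_ofPred_eq] at he he' ⊢
    rw [map_mul, mul_assoc, he', ← mul_assoc, he, mul_assoc]

variable {p c}

theorem of_mem_twistFixed {g : G} (h : p g * c = c * g) :
    MonoidAlgebra.of ℤ G g ∈ twistFixed p c := by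
  change _ * _ = _ * _
  rw [mapDomainRingHom_of, ← map_mul, h, map_mul]

theorem powSum_mem_twistFixed {g : G} (h : p g * c = c * g) (n : ℕ) :
    powSum g n ∈ twistFixed p c :=
  sum_mem fun i _ => pow_mem (of_mem_twistFixed h) i

theorem mulTwist_mul {e : MonoidAlgebra ℤ G} (he : e ∈ twistFixed p c) (r : MonoidAlgebra ℤ G) :
    mulTwist p c r * e = mulTwist p c (r * e) := by
  have h : _ * _ = _ * _ := he
  rw [mulTwist_apply, mulTwist_apply, map_mul, mul_assoc, ← h, mul_assoc]

theorem quatNorm_mem_twistFixed {x y : G} (hx : p x * c = c * x) (hy : p y * c = c * y) (m : ℕ) :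
    quatNorm x y m ∈ twistFixed p c :=
  mul_mem (powSum_mem_twistFixed hx _) (add_mem (one_mem _) (of_mem_twistFixed hy))

/-- All entries of the differentials are polynomials in `x` and `y`, hence lie in the subring
`twistFixed`; so the twist commutes with every differential. -/
theorem _root_.QuaternionPair.twistMap_eq_id {x y : G} {m : ℕ} (h : QuaternionPair x y m)
    (hx : p x * c = c * x) (hy : p y * c = c * y) :
    twistMap p
      (rangeTwist (mulRight (quatNorm x y m)) (mulTwist p c) (mulTwist p c)
        (mulTwist_mul (quatNorm_mem_twistFixed hx hy m)))
      ((semilinear_mulTwist p c).rangeTwist _ _ _) 3 = 𝟙 _ := by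
  have hX := of_mem_twistFixed hx
  have hY := of_mem_twistFixed hy
  have h1 : (1 : MonoidAlgebra ℤ G) ∈ twistFixed p c := one_mem _
  refine h.periodicResolution.twistMap_three_eq_id (mulTwist p c)
    ((mulTwist p c).prodMap (mulTwist p c)) (semilinear_mulTwist p c)
    (fun g m => Prod.ext (semilinear_mulTwist p c g m.1) (semilinear_mulTwist p c g m.2))
    (augmentation_mulTwist p c) _ ?_ ?_ ?_
  · rintro ⟨u, v⟩
    refine Eq.trans ?_ (map_add (mulTwist p c) _ _).symm
    exact congrArg₂ (· + ·) (mulTwist_mul (sub_mem hX h1) u) (mulTwist_mul (sub_mem hY h1) v)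
  · rintro ⟨u, v⟩
    refine Prod.ext ?_ ?_
    · refine Eq.trans ?_ (map_add (mulTwist p c) _ _).symm
      exact congrArg₂ (· + ·) (mulTwist_mul (powSum_mem_twistFixed hx m) u)
        (mulTwist_mul (add_mem h1 (mul_mem hX hY)) v)
    · refine Eq.trans ?_ (map_add (mulTwist p c) _ _).symm
      refine congrArg₂ (· + ·) (Eq.trans ?_ (map_neg (mulTwist p c) _).symm)
        (mulTwist_mul (sub_mem hX h1) v)
      exact congrArg Neg.neg (mulTwist_mul (add_mem h1 hY) u)
  · intro r
    exact Prod.ext (mulTwist_mul (sub_mem hX h1) r) (mulTwist_mul (sub_mem h1 (mul_mem hX hY)) r)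

end Twist

end GroupRing

/-! ### The quaternion subgroups of `π` -/

namespace KnotGroup

open GroupRing

theorem induction_on {p : Pi → Prop} (ha : p a) (hb : p b) (ht : p t)
    (hmul : ∀ g h, p g → p h → p (g * h)) (hinv : ∀ g, p g → p g⁻¹) (g : Pi) : p g := by
  have h1 : p 1 := by simpa using hmul _ _ ha (hinv _ ha)
  have h : g ∈ Subgroup.closure (Set.range (PresentedGroup.of : Gen → Pi)) := by
    rw [PresentedGroup.closure_range_of]
    trivial
  induction h using Subgroup.closure_induction with
  | mem x hx =>
    obtain ⟨i, rfl⟩ := hx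
    cases i
    · exact ha
    · exact hb
    · exact ht
  | one => exact h1
  | mul x y _ _ hx hy => exact hmul x y hx hy
  | inv x _ hx => exact hinv x hx

/-- A faithful representation of the base group over the field with 17 elements,
extended to the HNN extension. -/
def toMatrix : Pi →* (Matrix (Fin 2) (Fin 2) (ZMod 17))ˣ :=
  homOfImages
    ⟨!![2, 0; 0, 9], !![9, 0; 0, 2], by decide, by decide⟩
    ⟨!![0, 1; 16, 0], !![0, 16; 1, 0], by decide, by decide⟩
    ⟨!![2, 1; 8, 13], !![13, 16; 9, 2], by decide, by decide⟩
    (Units.ext (by decide)) (Units.ext (by decide)) (Units.ext (by decide)) (Units.ext (by decide))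

/-- The image of `a⁴` is `-1` modulo `17`. The resulting order of `a` is all that is needed to know
that the quaternion groups embed in `π`, in place of a normal form theorem for HNN extensions. -/
theorem a_pow_four_ne_one : a ^ 4 ≠ 1 := by
  intro h
  have h1 := congrArg toMatrix h
  rw [map_pow, map_one, toMatrix, homOfImages_a] at h1
  have h2 := congrArg Units.val h1
  revert h2
  decide

theorem orderOf_a : orderOf a = 8 :=
  orderOf_eq_prime_pow (p := 2) (n := 2) a_pow_four_ne_one a_pow_eight

theorem quaternionPair_base : QuaternionPair a b 4 where
  pow_eq := by rw [rel_three, pow_two]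
  conj := by rw [mul_assoc, b_mul_a, mul_inv_cancel_left]
  orderOf_eq := orderOf_a
  two_le := by norm_num

theorem quaternionPair_edge : QuaternionPair (a ^ 2) b 2 where
  pow_eq := by rw [← pow_mul, rel_three, pow_two]
  conj := by rw [mul_assoc, b_mul_a_pow, mul_inv_cancel_left]
  orderOf_eq := by
    rw [orderOf_pow' a two_ne_zero, orderOf_a]
    rfl
  two_le := le_rfl

theorem t_mul_a_sq : t * a ^ 2 = b * t := by
  rw [← rel_one]; group

theorem t_mul_a_mul_b : t * (a * b) = a ^ 2 * t := by
  rw [← rel_two]; group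

/-! ### Crossed homomorphisms out of `π` -/

section Cocycle

variable {M : Type} [AddCommGroup M] [Module (MonoidAlgebra ℤ Pi) M]

/-- The affine permutation of a module given by a group element and a translation. -/
noncomputable def affine (g : Pi) (e : M) : Equiv.Perm M where
  toFun m := MonoidAlgebra.of ℤ Pi g • m + e
  invFun m := MonoidAlgebra.of ℤ Pi g⁻¹ • (m - e)
  left_inv m := by
    beta_reduce
    rw [add_sub_cancel_right, ← mul_smul, ← map_mul, inv_mul_cancel, map_one, one_smul]
  right_inv m := by
    beta_reduce
    rw [← mul_smul, ← map_mul, mul_inv_cancel, map_one, one_smul, sub_add_cancel]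

theorem affine_mul (g h : Pi) (e e' : M) :
    affine g e * affine h e' = affine (g * h) (MonoidAlgebra.of ℤ Pi g • e' + e) := by
  ext m
  change MonoidAlgebra.of ℤ Pi g • (MonoidAlgebra.of ℤ Pi h • m + e') + e =
    MonoidAlgebra.of ℤ Pi (g * h) • m + (MonoidAlgebra.of ℤ Pi g • e' + e)
  rw [map_mul, mul_smul, smul_add, add_assoc]

/-- A crossed homomorphism is a lift of the action to affine maps, so it can be defined on
generators. The base relations hold with zero translation. The relations `t a² = b t` and `t (ab) =
a² t` require exactly that `b` and `a²` fix `e`. -/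
theorem exists_cocycle (e : M) (ha : MonoidAlgebra.of ℤ Pi (a ^ 2) • e = e)
    (hb : MonoidAlgebra.of ℤ Pi b • e = e) :
    ∃ D : Pi → M, D a = 0 ∧ D b = 0 ∧ D t = e ∧
      ∀ g h, D (g * h) = D g + MonoidAlgebra.of ℤ Pi g • D h := by
  let ψ : Pi →* Equiv.Perm M := homOfImages (affine a 0) (affine b 0) (affine t e)
    (by
      rw [mul_inv_eq_iff_eq_mul, pow_two, affine_mul, affine_mul, affine_mul, ← pow_two, t_mul_a_sq]
      simp [hb, -MonoidAlgebra.of_apply])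
    (by
      rw [mul_inv_eq_iff_eq_mul, pow_two, affine_mul, affine_mul, affine_mul, affine_mul,
        ← pow_two, t_mul_a_mul_b, ha]
      simp)
    (by
      rw [pow_succ, pow_succ, pow_two, pow_two]
      simp only [affine_mul, smul_zero, add_zero]
      rw [← pow_two, ← pow_succ, ← pow_succ, ← pow_two, rel_three])
    (by
      rw [pow_two, pow_two]
      simp only [affine_mul, smul_zero, add_zero]
      rw [← pow_two, ← pow_two, rel_four])
  have hψa : ψ a = affine a 0 := homOfImages_a _ _ _ _
  have hψb : ψ b = affine b 0 := homOfImages_b _ _ _ _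
  have hψt : ψ t = affine t e := homOfImages_t _ _ _ _
  have hψ : ∀ g, ∃ d, ψ g = affine g d := by
    intro g
    induction g using induction_on with
    | ha => exact ⟨_, hψa⟩
    | hb => exact ⟨_, hψb⟩
    | ht => exact ⟨_, hψt⟩
    | hmul g h hg hh =>
      obtain ⟨d, hd⟩ := hg
      obtain ⟨d', hd'⟩ := hh
      exact ⟨_, by rw [map_mul, hd, hd', affine_mul]⟩
    | hinv g hg =>
      obtain ⟨d, hd⟩ := hg
      refine ⟨-(MonoidAlgebra.of ℤ Pi g⁻¹ • d), ?_⟩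
      rw [map_inv, hd]
      ext m
      change MonoidAlgebra.of ℤ Pi g⁻¹ • (m - d) = MonoidAlgebra.of ℤ Pi g⁻¹ • m + _
      rw [smul_sub, sub_eq_add_neg]
  have h0 : ∀ (g : Pi) (d : M), affine g d 0 = d := fun g d => by
    change MonoidAlgebra.of ℤ Pi g • (0 : M) + d = d
    rw [smul_zero, zero_add]
  refine ⟨fun g => ψ g 0, by simp only [hψa, h0], by simp only [hψb, h0], by simp only [hψt, h0],
    fun g h => ?_⟩
  obtain ⟨d, hd⟩ := hψ g
  obtain ⟨d', hd'⟩ := hψ h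
  simp only [map_mul, hd, hd', affine_mul, h0, add_comm]

end Cocycle

end KnotGroup

namespace GroupRing

section RangeLift

variable {G : Type} [Group G] {P Q : Type} [AddCommGroup P] [Module (MonoidAlgebra ℤ G) P]
  [AddCommGroup Q] [Module (MonoidAlgebra ℤ G) Q] {A : Type} [AddCommGroup A]
  (d : P →ₗ[MonoidAlgebra ℤ G] Q) (l : P →+ A) (h : ∀ m, d m = 0 → l m = 0)

include h in
theorem apply_choose_range (m : P) (x : LinearMap.range d) (hx : d m = x) :
    l x.2.choose = l m := by
  rw [← sub_eq_zero, ← map_sub]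
  apply h
  rw [map_sub, x.2.choose_spec, hx, sub_self]

/-- The map on the range of `d` induced by a map that vanishes on the kernel of `d`. -/
noncomputable def rangeLift : LinearMap.range d →+ A where
  toFun x := l x.2.choose
  map_zero' := by rw [apply_choose_range d l h 0 _ (map_zero d), map_zero]
  map_add' x y := by
    rw [← map_add, apply_choose_range d l h (x.2.choose + y.2.choose)]
    rw [map_add, x.2.choose_spec, y.2.choose_spec]
    rfl

theorem rangeLift_apply (m : P) (x : LinearMap.range d) (hx : d m = x) :
    rangeLift d l h x = l m := apply_choose_range d l h m x hx

end RangeLift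

end GroupRing

/-! ### Norm identities relating the edge and base groups -/

namespace KnotGroup

open GroupRing

/-- The norm element of the base group. -/
noncomputable abbrev baseNorm : MonoidAlgebra ℤ Pi := quatNorm a b 4

/-- The norm element of the edge group. -/
noncomputable abbrev edgeNorm : MonoidAlgebra ℤ Pi := quatNorm (a ^ 2) b 2

/-- `Q(16)` is the disjoint union of `Q(8)` and `Q(8)a`. -/
theorem edgeNorm_mul_one_add_a : edgeNorm * (1 + MonoidAlgebra.of ℤ Pi a) = baseNorm := by
  have h1 : powSum (a ^ 2) (2 * 2) * (1 + MonoidAlgebra.of ℤ Pi a) = powSum a (2 * 4) := by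
    simp only [powSum, map_pow, Finset.sum_range_succ, Finset.sum_range_zero]
    noncomm_ring
  have h2 := quaternionPair_base.relations.y_N
  have h3 := quaternionPair_edge.relations.y_N
  rw [edgeNorm, baseNorm, quatNorm, quatNorm, ← h1]
  rw [← h1] at h2
  linear_combination (norm := noncomm_ring) h2 - h3 * (1 + MonoidAlgebra.of ℤ Pi a)

/-- Conjugation by `t⁻¹` carries `⟨a², b⟩` to `⟨ab, a²⟩`, again of index two in `Q(16)` and not
containing `a`. Moving the edge norm past `t` and multiplying by `1 + a` therefore gives the base
norm once more. -/
theorem edgeNorm_mul : edgeNorm * ((MonoidAlgebra.of ℤ Pi t - 1) * (1 + MonoidAlgebra.of ℤ Pi a)) =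
    (MonoidAlgebra.of ℤ Pi t - 1) * baseNorm := by
  have h0 := edgeNorm_mul_one_add_a
  have h1 : MonoidAlgebra.of ℤ Pi t * MonoidAlgebra.of ℤ Pi a ^ 2 =
      MonoidAlgebra.of ℤ Pi b * MonoidAlgebra.of ℤ Pi t := by
    rw [← map_pow, ← map_mul, ← map_mul, t_mul_a_sq]
  have h2 : MonoidAlgebra.of ℤ Pi t * (MonoidAlgebra.of ℤ Pi a * MonoidAlgebra.of ℤ Pi b) =
      MonoidAlgebra.of ℤ Pi a ^ 2 * MonoidAlgebra.of ℤ Pi t := by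
    rw [← map_pow, ← map_mul, ← map_mul, ← map_mul, t_mul_a_mul_b]
  have h3 : (MonoidAlgebra.of ℤ Pi a * MonoidAlgebra.of ℤ Pi b) ^ 2 =
      MonoidAlgebra.of ℤ Pi a ^ 4 := by
    rw [← map_pow, ← map_mul, ← map_pow, rel_three, rel_four]
  have h4 := quaternionPair_base.relations.y_N
  have h5 := quaternionPair_base.relations.x_N
  have h6 : edgeNorm * MonoidAlgebra.of ℤ Pi t * (1 + MonoidAlgebra.of ℤ Pi a) =
      MonoidAlgebra.of ℤ Pi t * baseNorm := by
    rw [edgeNorm, baseNorm, quatNorm, quatNorm]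
    simp only [powSum, map_pow, Finset.sum_range_succ, Finset.sum_range_zero] at h4 h5 ⊢
    generalize MonoidAlgebra.of ℤ Pi a = A at *
    generalize MonoidAlgebra.of ℤ Pi b = B at *
    generalize MonoidAlgebra.of ℤ Pi t = T at *
    have e1 : T * (A * B) ^ 2 = A ^ 4 * T := by
      rw [pow_two, ← mul_assoc, h2, mul_assoc, h2]
      noncomm_ring
    have e2 : T * (A * B) ^ 3 = A ^ 6 * T := by
      rw [pow_succ, ← mul_assoc, e1, mul_assoc, h2]
      noncomm_ring
    have e3 : (1 + A ^ 2 + A ^ 4 + A ^ 6) * T = T * ((1 + A * B) * (1 + A ^ 4)) := by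
      linear_combination (norm := noncomm_ring) -h2 - e1 - e2 + T * (1 + A * B) * h3
    calc _ = (1 + A ^ 2 + A ^ 4 + A ^ 6) * T * (1 + A ^ 2) * (1 + A) := by
          linear_combination (norm := noncomm_ring) -(1 + A ^ 2 + A ^ 4 + A ^ 6) * h1 * (1 + A)
      _ = T * ((1 + A * B) * ((1 + A ^ 4) * (1 + A ^ 2) * (1 + A))) := by
          rw [e3]; noncomm_ring
      _ = _ := by
          linear_combination (norm := noncomm_ring) T * A * h4 + T * h5 * B
  linear_combination (norm := noncomm_ring) h6 - h0

end KnotGroup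

/-! ### The exact sequence of the tree -/

namespace KnotGroup

open GroupRing groupHomology

/-- The element of the group ring that represents the boundary of an edge of the tree on which
`π` acts. -/
noncomputable abbrev boundaryElt : MonoidAlgebra ℤ Pi :=
  (MonoidAlgebra.of ℤ Pi t - 1) * (1 + MonoidAlgebra.of ℤ Pi a)

theorem a_mul_baseNorm : MonoidAlgebra.of ℤ Pi a * baseNorm = baseNorm :=
  quaternionPair_base.relations.x_norm

theorem b_mul_baseNorm : MonoidAlgebra.of ℤ Pi b * baseNorm = baseNorm :=
  quaternionPair_base.relations.y_norm

/-- The boundary map from the edges to the vertices of the tree. -/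
noncomputable def boundary : leftIdeal edgeNorm →ₗ[MonoidAlgebra ℤ Pi] leftIdeal baseNorm :=
  ((mulRight boundaryElt).comp (leftIdeal edgeNorm).subtype).codRestrict _ (by
    rintro ⟨_, r, rfl⟩
    refine ⟨r * (MonoidAlgebra.of ℤ Pi t - 1), ?_⟩
    change r * (MonoidAlgebra.of ℤ Pi t - 1) * baseNorm = r * edgeNorm * boundaryElt
    rw [mul_assoc, mul_assoc, edgeNorm_mul])

theorem coe_boundary (x : leftIdeal edgeNorm) : (boundary x : MonoidAlgebra ℤ Pi) =
    x * boundaryElt := rfl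

theorem augmentation_eq_zero_of_mul_baseNorm (r : MonoidAlgebra ℤ Pi)
    (hr : mulRight baseNorm r = 0) : augmentation.toAddMonoidHom r = 0 := by
  have h := congrArg augmentation hr
  rw [mulRight_apply, map_mul, augmentation_quatNorm, map_zero] at h
  exact (mul_eq_zero.1 h).resolve_right (by norm_num)

/-- The augmentation on the vertices of the tree. -/
noncomputable def vertexAug : leftIdeal baseNorm →+ ℤ :=
  rangeLift (mulRight baseNorm) augmentation.toAddMonoidHom augmentation_eq_zero_of_mul_baseNorm

theorem vertexAug_eq (r : MonoidAlgebra ℤ Pi) (x : leftIdeal baseNorm) (h : r * baseNorm = x) :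
    vertexAug x = augmentation r :=
  rangeLift_apply (mulRight baseNorm) augmentation.toAddMonoidHom
    augmentation_eq_zero_of_mul_baseNorm r x h

theorem vertexAug_of_smul (g : Pi) (x : leftIdeal baseNorm) :
    vertexAug (MonoidAlgebra.of ℤ Pi g • x) = vertexAug x := by
  obtain ⟨r, hr⟩ := x.2
  have h : MonoidAlgebra.of ℤ Pi g * r * baseNorm =
      (MonoidAlgebra.of ℤ Pi g • x : leftIdeal baseNorm) :=
    (mul_assoc _ _ _).trans (congrArg (MonoidAlgebra.of ℤ Pi g * ·) hr)
  rw [vertexAug_eq _ _ h, vertexAug_eq r x hr, map_mul, augmentation_of, one_mul]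

/-- The generator of the edge module. -/
noncomputable def edge : leftIdeal edgeNorm := (mulRight edgeNorm).rangeRestrict 1

theorem coe_edge : (edge : MonoidAlgebra ℤ Pi) = edgeNorm := one_mul _

theorem exists_edgeCocycle : ∃ D : Pi → leftIdeal edgeNorm, D a = 0 ∧ D b = 0 ∧ D t = edge ∧
    ∀ g h, D (g * h) = D g + MonoidAlgebra.of ℤ Pi g • D h := by
  have h := quaternionPair_edge.relations
  refine exists_cocycle edge (Subtype.ext ?_) (Subtype.ext ?_)
  · change MonoidAlgebra.of ℤ Pi (a ^ 2) * (edge : MonoidAlgebra ℤ Pi) = edge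
    rw [coe_edge]
    exact h.x_norm
  · change MonoidAlgebra.of ℤ Pi b * (edge : MonoidAlgebra ℤ Pi) = edge
    rw [coe_edge]
    exact h.y_norm

theorem cocycle_one {M : Type} [AddCommGroup M] [Module (MonoidAlgebra ℤ Pi) M] {D : Pi → M}
    (hD : ∀ g h, D (g * h) = D g + MonoidAlgebra.of ℤ Pi g • D h) : D 1 = 0 := by
  have h := hD 1 1
  rw [mul_one, map_one, one_smul] at h
  exact left_eq_add.1 h

/-- Both sides are crossed homomorphisms in `g`, so agreement on generators suffices. Geometrically,
`D g` is the path in the tree from the base vertex to its translate by `g`. -/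
theorem boundary_cocycle {D : Pi → leftIdeal edgeNorm} (ha : D a = 0) (hb : D b = 0)
    (ht : D t = edge) (hD : ∀ g h, D (g * h) = D g + MonoidAlgebra.of ℤ Pi g • D h) (g : Pi) :
    (D g : MonoidAlgebra ℤ Pi) * boundaryElt = (MonoidAlgebra.of ℤ Pi g - 1) * baseNorm := by
  induction g using induction_on with
  | ha =>
    rw [ha, Submodule.coe_zero, zero_mul, sub_mul, one_mul, a_mul_baseNorm, sub_self]
  | hb =>
    rw [hb, Submodule.coe_zero, zero_mul, sub_mul, one_mul, b_mul_baseNorm, sub_self]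
  | ht => rw [ht, coe_edge, edgeNorm_mul]
  | hmul g k hg hk =>
    rw [hD, map_mul, Submodule.coe_add, Submodule.coe_smul, smul_eq_mul]
    linear_combination (norm := noncomm_ring) hg + MonoidAlgebra.of ℤ Pi g * hk
  | hinv g hg =>
    have h1 := hD g⁻¹ g
    rw [inv_mul_cancel, cocycle_one hD] at h1
    have h2 : (D g⁻¹ : MonoidAlgebra ℤ Pi) = -(MonoidAlgebra.of ℤ Pi g⁻¹ * D g) := by
      rw [eq_neg_of_add_eq_zero_left h1.symm]
      rfl
    have h3 : MonoidAlgebra.of ℤ Pi g⁻¹ * MonoidAlgebra.of ℤ Pi g = 1 := by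
      rw [← map_mul, inv_mul_cancel, map_one]
    rw [h2]
    linear_combination (norm := noncomm_ring) -MonoidAlgebra.of ℤ Pi g⁻¹ * hg - h3 * baseNorm

/-- If `r * edgeNorm` has zero boundary, then `r * (t - 1)` kills the base norm, so it is a
combination of `a - 1` and `b - 1`. The linear extension of the cocycle sends `q * (g - 1)` to `q •
D g`; as `D` vanishes at `a` and `b`, this gives `r • edge = 0`. -/
theorem boundary_injective : Function.Injective boundary := by
  rw [← LinearMap.ker_eq_bot, LinearMap.ker_eq_bot']
  rintro ⟨_, r, rfl⟩ hr
  obtain ⟨D, ha, hb, ht, hD⟩ := exists_edgeCocycle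
  have h1 : r * (MonoidAlgebra.of ℤ Pi t - 1) * baseNorm = 0 := by
    rw [mul_assoc, ← edgeNorm_mul, ← mul_assoc]
    exact congrArg Subtype.val hr
  obtain ⟨u, v, huv⟩ := (quaternionPair_base.relations.exact₀ _).1 h1
  have h2 : ∀ (g : Pi) (q : MonoidAlgebra ℤ Pi),
      linExt D (q * (MonoidAlgebra.of ℤ Pi g - 1)) = q • D g := by
    intro g q
    suffices h : linExt D ∘ₗ LinearMap.mulRight ℤ (MonoidAlgebra.of ℤ Pi g - 1) =
        ((LinearMap.toSpanSingleton (MonoidAlgebra ℤ Pi) _ (D g)).toAddMonoidHom.toIntLinearMap) from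
      LinearMap.congr_fun h q
    refine linearMap_ext fun k => ?_
    change linExt D (MonoidAlgebra.of ℤ Pi k * (MonoidAlgebra.of ℤ Pi g - 1)) =
      MonoidAlgebra.of ℤ Pi k • D g
    rw [mul_sub, mul_one, ← map_mul, map_sub, linExt_of, linExt_of, hD, add_sub_cancel_left]
  have h3 : r • D t = 0 := by
    rw [← h2, ← huv, map_add, h2, h2, ha, hb, smul_zero, smul_zero, add_zero]
  rw [ht] at h3
  rw [← h3]
  refine Subtype.ext ?_
  change r * edgeNorm = r * (edge : MonoidAlgebra ℤ Pi)
  rw [coe_edge]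

theorem vertexAug_boundary (x : leftIdeal edgeNorm) : vertexAug (boundary x) = 0 := by
  obtain ⟨_, r, rfl⟩ := x
  rw [vertexAug_eq (r * (MonoidAlgebra.of ℤ Pi t - 1))]
  · simp [-MonoidAlgebra.of_apply]
  · rw [coe_boundary]
    change _ = r * edgeNorm * boundaryElt
    rw [mul_assoc, mul_assoc, edgeNorm_mul]

theorem exact_boundary_vertexAug : Function.Exact boundary vertexAug := by
  intro x
  constructor
  · obtain ⟨_, r, rfl⟩ := x
    intro hr
    rw [vertexAug_eq r _ rfl] at hr
    obtain ⟨D, ha, hb, ht, hD⟩ := exists_edgeCocycle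
    -- Extended linearly, the cocycle has boundary `r * baseNorm` minus the augmentation of `r`
    -- times `baseNorm`, and here that augmentation is zero.
    refine ⟨linExt D r, Subtype.ext ?_⟩
    have h : LinearMap.mulRight ℤ boundaryElt ∘ₗ
        (leftIdeal edgeNorm).subtype.toAddMonoidHom.toIntLinearMap ∘ₗ linExt D =
        LinearMap.mulRight ℤ baseNorm -
          (augmentation.toAddMonoidHom.toIntLinearMap).smulRight baseNorm := by
      refine linearMap_ext fun g => ?_
      change (linExt D (MonoidAlgebra.of ℤ Pi g) : MonoidAlgebra ℤ Pi) * boundaryElt =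
        MonoidAlgebra.of ℤ Pi g * baseNorm - augmentation (MonoidAlgebra.of ℤ Pi g) • baseNorm
      rw [linExt_of, boundary_cocycle ha hb ht hD, augmentation_of, one_smul, sub_mul, one_mul]
    refine (LinearMap.congr_fun h r).trans ?_
    change r * baseNorm - augmentation r • baseNorm = r * baseNorm
    rw [hr, zero_smul, sub_zero]
  · rintro ⟨y, rfl⟩
    exact vertexAug_boundary y

theorem vertexAug_surjective : Function.Surjective vertexAug := by
  intro n
  refine ⟨n • (mulRight baseNorm).rangeRestrict 1, ?_⟩
  rw [map_zsmul, vertexAug_eq 1 _ rfl, map_one, smul_eq_mul, mul_one]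

/-- The short exact sequence of the tree on which `π` acts. -/
noncomputable def treeSeq : ShortComplex (Rep.{0} ℤ Pi) where
  X₁ := rep (leftIdeal edgeNorm)
  X₂ := rep (leftIdeal baseNorm)
  X₃ := Rep.trivial ℤ Pi ℤ
  f := repHom boundary
  g := Rep.ofHom ⟨vertexAug.toIntLinearMap, fun g => by ext x; exact vertexAug_of_smul g x⟩
  zero := by
    ext x
    exact vertexAug_boundary x

theorem treeSeq_shortExact : treeSeq.ShortExact :=
  shortExact_of_exact _ boundary_injective exact_boundary_vertexAug vertexAug_surjective

end KnotGroup

/-! ### Homology of `π` and the action of the automorphisms -/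

namespace KnotGroup

open GroupRing groupHomology

/-- The connecting homomorphism from the homology of `π` to the homology of the edge module. -/
noncomputable def toEdge (n : ℕ) :
    integralHomology Pi (n + 1) ⟶ groupHomology (rep (G := Pi) (leftIdeal edgeNorm)) n :=
  δ treeSeq_shortExact (n + 1) n rfl

theorem mono_toEdge : Mono (toEdge 3) :=
  mono_δ_of_isZero treeSeq_shortExact 3
    (quaternionPair_base.periodicResolution.isZero_four
      (by rw [augmentation_quatNorm]; norm_num))

/-- The edge module is twisted by `r ↦ p(r)c` and the vertex module by `r ↦ p(r)`. The hypotheses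
`hx` and `hy` make the former trivial on `H₃`, while `ht` says that the translate by `c` of the base
edge has the boundary that `p` prescribes. -/
theorem integralHomologyMap_eq_id (p : Pi →* Pi) (c : Pi) (hx : p (a ^ 2) * c = c * a ^ 2)
    (hy : p b * c = c * b) (hbase : MonoidAlgebra.mapDomainRingHom ℤ p baseNorm = baseNorm)
    (ht : MonoidAlgebra.of ℤ Pi c * ((MonoidAlgebra.of ℤ Pi t - 1) * baseNorm) =
      (MonoidAlgebra.of ℤ Pi (p t) - 1) * baseNorm) :
    integralHomologyMap p 4 = 𝟙 (integralHomology Pi 4) := by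
  have hedge := quatNorm_mem_twistFixed hx hy 2
  have hbase' : ∀ r, mulRight baseNorm (mulTwist p 1 r) = mulTwist p 1 (mulRight baseNorm r) :=
    fun r => by
      change MonoidAlgebra.mapDomainRingHom ℤ p r * MonoidAlgebra.of ℤ Pi 1 * baseNorm =
        MonoidAlgebra.mapDomainRingHom ℤ p (r * baseNorm) * MonoidAlgebra.of ℤ Pi 1
      rw [map_one, mul_one, mul_one, map_mul, hbase]
  have h₁₂ : ∀ x, boundary (rangeTwist (mulRight edgeNorm) (mulTwist p c) (mulTwist p c)
      (mulTwist_mul hedge) x) =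
      rangeTwist (mulRight baseNorm) (mulTwist p 1) (mulTwist p 1) hbase' (boundary x) := by
    rintro ⟨_, r, rfl⟩
    refine Subtype.ext ?_
    change mulTwist p c (r * edgeNorm) * boundaryElt = mulTwist p 1 (r * edgeNorm * boundaryElt)
    rw [← mulTwist_mul hedge, mul_assoc, mul_assoc, edgeNorm_mul, mulTwist_apply, mulTwist_apply,
      mul_assoc, ht, map_mul, map_mul, hbase, map_sub, map_one, map_one, mapDomainRingHom_of,
      mul_one]
  have h₂₃ : ∀ x, vertexAug (rangeTwist (mulRight baseNorm) (mulTwist p 1) (mulTwist p 1) hbase' x) =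
      vertexAug x := by
    rintro ⟨_, r, rfl⟩
    exact (vertexAug_eq (mulTwist p 1 r) (rangeTwist (mulRight baseNorm) (mulTwist p 1)
      (mulTwist p 1) hbase' ⟨_, r, rfl⟩) (hbase' r)).trans
      ((augmentation_mulTwist p 1 r).trans (vertexAug_eq r _ rfl).symm)
  have := mono_toEdge
  have key := δ_comp_map treeSeq_shortExact treeSeq_shortExact p
    (twistHom p _ ((semilinear_mulTwist p c).rangeTwist (mulRight edgeNorm) (mulTwist p c)
      (mulTwist_mul hedge)))
    (twistHom p _ ((semilinear_mulTwist p 1).rangeTwist (mulRight baseNorm) (mulTwist p 1) hbase'))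
    (𝟙 (Rep.trivial ℤ Pi ℤ)) h₁₂ h₂₃ 4 3 rfl
  have hid := quaternionPair_edge.twistMap_eq_id hx hy
  have key' : toEdge 3 = integralHomologyMap p 4 ≫ toEdge 3 := by
    refine Eq.trans ?_ key
    refine Eq.trans ?_ (congrArg (toEdge 3 ≫ ·) hid).symm
    exact (Category.comp_id _).symm
  rw [← cancel_mono (toEdge 3), ← key', Category.id_comp]

theorem integralHomologyMap_f : integralHomologyMap f.toMonoidHom 4 = 𝟙 (integralHomology Pi 4) := by
  have ha : f.toMonoidHom a = a := fHom_a
  have hb : f.toMonoidHom b = b := fHom_b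
  have ht : f.toMonoidHom t = a ^ 4 * t := fHom_t
  -- As `f` fixes `Q(8)` pointwise no correction is needed; the factor `a⁴` commutes with `t` and is
  -- absorbed by the base norm.
  refine integralHomologyMap_eq_id _ 1 ?_ ?_ ?_ ?_
  · rw [map_pow, ha, mul_one, one_mul]
  · rw [hb, mul_one, one_mul]
  · have h := quatNorm_mem_twistFixed (p := f.toMonoidHom) (c := 1) (x := a) (y := b)
      (by rw [ha, mul_one, one_mul]) (by rw [hb, mul_one, one_mul]) 4
    have h' : _ * _ = _ * _ := h
    rwa [map_one, mul_one, one_mul] at h'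
  · rw [ht, map_one, one_mul, ← t_mul_a_pow_four, sub_mul, sub_mul, map_mul, mul_assoc, map_pow,
      pow_succ, pow_succ, pow_two]
    simp only [mul_assoc, a_mul_baseNorm]

theorem integralHomologyMap_g : integralHomologyMap g.toMonoidHom 4 = 𝟙 (integralHomology Pi 4) := by
  have ha : g.toMonoidHom a = a⁻¹ := gHom_a
  have hb : g.toMonoidHom b = (a ^ 2)⁻¹ * b := gHom_b
  have ht : g.toMonoidHom t = a * t := gHom_t
  -- Conjugation by `a³b` acts on `a²` and `b` as `g` does, and `a³b` carries the coset `tQ(16)` to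
  -- `atQ(16)`.
  refine integralHomologyMap_eq_id _ (a ^ 3 * b) ?_ ?_ ?_ ?_
  · rw [map_pow, ha, mul_assoc, b_mul_a_pow]
    group
  · rw [hb, mul_assoc, ← mul_assoc b, b_mul_a_pow]
    have h : (a ^ 2)⁻¹ * ((a ^ 3)⁻¹ * b * b) = a ^ 3 * (a ^ 8)⁻¹ * b * b := by group
    rw [h, a_pow_eight, inv_one, mul_one]
  -- `a⁻¹` generates the same cyclic group as `a`, so the two sums of powers agree.
  · have h₁ : QuaternionPair a⁻¹ b 4 :=
      { pow_eq := by
          rw [inv_pow, inv_eq_iff_mul_eq_one, ← pow_two, ← rel_three, ← pow_add]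
          exact a_pow_eight
        conj := by
          rw [mul_inv_eq_iff_eq_mul, b_mul_a]
        orderOf_eq := by rw [orderOf_inv, orderOf_a]
        two_le := by norm_num }
    have h₂ : powSum a⁻¹ (2 * 4) = powSum a (2 * 4) := by
      rw [← h₁.normElt_powers, ← quaternionPair_base.normElt_powers]
      congr 1
      ext x
      rw [h₁.mem_powers, quaternionPair_base.mem_powers, Subgroup.zpowers_inv]
    have h₃ : powSum a (2 * 4) * MonoidAlgebra.of ℤ Pi (a ^ 2)⁻¹ = powSum a (2 * 4) := by
      have h₄ := mul_pow_eq_self quaternionPair_base.relations.N_x 2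
      conv_lhs => rw [← h₄]
      rw [← map_pow, mul_assoc, ← map_mul, mul_inv_cancel, map_one, mul_one]
    have h₅ : MonoidAlgebra.mapDomainRingHom ℤ g.toMonoidHom (powSum a (2 * 4)) =
        powSum a⁻¹ (2 * 4) := by
      rw [powSum, map_sum]
      simp only [map_pow, mapDomainRingHom_of, ha]
      rfl
    rw [baseNorm, quatNorm, map_mul, h₅, h₂, map_add, map_one, mapDomainRingHom_of, hb, map_mul,
      mul_add, mul_add, ← mul_assoc, h₃]
  · have h : a ^ 3 * b * t = a * t * (a * b * a ^ 2) := by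
      calc a ^ 3 * b * t = a ^ 3 * (t * a ^ 2) := by rw [t_mul_a_sq, mul_assoc]
        _ = a * (a ^ 2 * t) * a ^ 2 := by simp only [pow_succ, pow_zero, one_mul, mul_assoc]
        _ = a * t * (a * b * a ^ 2) := by rw [← t_mul_a_mul_b]; simp only [mul_assoc]
    rw [ht, sub_mul, mul_sub, one_mul, ← mul_assoc, ← map_mul, h, sub_mul, one_mul]
    simp only [map_mul, mul_assoc, pow_succ, pow_zero, one_mul, a_mul_baseNorm,
      b_mul_baseNorm]

theorem isAddCyclic_homology_four : IsAddCyclic (integralHomology Pi 4) ∧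
    Nat.card (integralHomology Pi 4) ∣ 8 := by
  have := mono_toEdge
  have hP := quaternionPair_edge.periodicResolution
  have := hP.mono_dimShift
  let ψ := toEdge 3 ≫ hP.dimShift
  have hψ : Function.Injective ψ := (ModuleCat.mono_iff_injective ψ).1 inferInstance
  have hcyc : IsAddCyclic (groupHomology (rep (G := Pi) (LinearMap.range (quatD₃ (a ^ 2) b))) 0) :=
    ⟨hP.gen, fun y => by
      obtain ⟨n, rfl⟩ := hP.exists_eq_zsmul_gen y
      exact ⟨n, rfl⟩⟩
  have h₁ : IsAddCyclic (integralHomology Pi 4) :=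
    isAddCyclic_of_injective ψ.hom.toAddMonoidHom hψ
  refine ⟨h₁, ?_⟩
  -- An infinite group would have `Nat.card` equal to `0`, which does not divide `8`; the
  -- divisibility thus includes finiteness.
  rw [← IsAddCyclic.exponent_eq_card]
  refine AddMonoid.exponent_dvd_of_forall_nsmul_eq_zero fun x => hψ ?_
  have h8 := hP.augmentation_zsmul_eq_zero (ψ x)
  rw [augmentation_quatNorm] at h8
  rw [map_nsmul, map_zero, ← h8, ← natCast_zsmul]
  rfl

theorem nontrivial_homology_three : Nontrivial (integralHomology Pi 3) := by
  by_contra hn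
  rw [not_nontrivial_iff_subsingleton] at hn
  have hA := quaternionPair_edge.periodicResolution
  have hB := quaternionPair_base.periodicResolution
  have := hA.mono_dimShift
  have hψ : Function.Injective hA.dimShift := (ModuleCat.mono_iff_injective _).1 inferInstance
  obtain ⟨z, hz⟩ := hB.exists_dimShift_eq_gen
  obtain ⟨w, hw⟩ : ∃ w, homologyMap boundary 3 w = z := (ShortComplex.moduleCat_exact_iff _).1
    (mapShortComplex₂_exact treeSeq_shortExact 3) z (hn.elim _ _)
  have h₁ : (8 : ℤ) • w = 0 := hψ (by
    have h8 := hA.augmentation_zsmul_eq_zero (hA.dimShift w)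
    rw [augmentation_quatNorm] at h8
    rw [map_zsmul, map_zero, ← h8]
    rfl)
  -- The generator for `Q(16)` is now the image of a class killed by `8`, although only multiples of
  -- `16` annihilate it.
  have h₂ : (8 : ℤ) • hB.gen = 0 := by
    rw [← hz, ← hw, ← map_zsmul, ← map_zsmul, h₁, map_zero, map_zero]
  have h₃ := hB.augmentation_dvd_of_zsmul_gen h₂
  rw [augmentation_quatNorm] at h₃
  norm_num at h₃

end KnotGroup

theorem mainTheorem7 :
    (IsAddCyclic (integralHomology KnotGroup.Pi 4) ∧
      Nat.card (integralHomology KnotGroup.Pi 4) ∣ 8) ∧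
    Nontrivial (integralHomology KnotGroup.Pi 3) ∧
    integralHomologyMap KnotGroup.f.toMonoidHom 4 = 𝟙 (integralHomology KnotGroup.Pi 4) ∧
    integralHomologyMap KnotGroup.g.toMonoidHom 4 = 𝟙 (integralHomology KnotGroup.Pi 4) :=
  ⟨KnotGroup.isAddCyclic_homology_four, KnotGroup.nontrivial_homology_three,
    KnotGroup.integralHomologyMap_f, KnotGroup.integralHomologyMap_g⟩
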